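/- Let $\lambda,\rho>0$ and let $0=\tau_0<\tau_1<\tau_2<\cdots$ (trading dates) and $Z_1,Z_2,\dots$ (returns; $Z_0$ is a constant) be real random variables on a probability space such that the pairs $(\tau_k-\tau_{k-1},Z_k)$, $k\ge1$, are i.i.d. with law $\mathrm{Exp}(\lambda)\otimes p$ (stationary case). Assume that $p$ is a probability measure on $\mathbb R$ and that there are $\underline z\in(0,1]$ and $\bar z\in(0,+\infty]$ such that the support of $p$ is either an interval with interior $(-\underline z,\bar z)$ or a finite set with least element $-\underline z$ and greatest element $\bar z<\infty$. Assume that $\int |z|\,p(dz)<\infty$, $\int z\,p(dz)\ge0$, and that for some constants $k,b\ge0$, $\int(1+z)\,p(dz)\le k e^{bt}$ for all $t\ge0$. Let $U:\mathbb R_+\to\mathbb R$ be strictly increasing and strictly concave, $C^1$ on $(0,\infty)$, with $U(0)=0$, $U'(0^+)=+\infty$, $U'(+\infty)=0$, and $U(x)\le K_1x^\gamma$ for all $x\ge0$, for some $K_1>0$ and $\gamma\in(0,1)$. Assume $\rho>b\gamma+\lambda\left(\frac{k^\gamma}{\underline z^\gamma}-1\right)$. Let $\mathcal G_t=\sigma\{(\tau_k,Z_k):\tau_k\le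 t\}$. For $x\ge0$ let $\mathcal A(x)$ be the set of pairs $(\alpha,c)$ where $\alpha_k$ is a real $\mathcal G_{\tau_{k-1}}$-measurable random variable for each $k\ge1$, $c=(c_t)_{t\ge0}$ is a nonnegative $(\mathcal G_t)$-predictable process, and almost surely $$x-\int_0^{\tau_k}c_t\,dt+\sum_{i=1}^k\alpha_iZ_i\ge0\quad\text{for all }k\ge1 .$$ Put $v(x)=\sup_{(\alpha,c)\in\mathcal A(x)}\mathbb E\left[\int_0^\infty e^{-\rho t}U(c_t)\,dt\right]$. Let $A=\mathbb R$ and $l(a)=\max(a\underline z,-a\bar z)$ if $\bar z<\infty$; let $A=\mathbb R_+$ and $l(a)=a\underline z$ if $\bar z=\infty$. For $a\in A$ and $x\ge l(a)$ let $\mathcal C_a(x)$ be the set of measurable $c:[0,\infty)\to[0,\infty)$ with $\int_0^tc_u\,du\le x-l(a)$ for all $t\ge0$, write $Y_s=x-\int_0^sc_u\,du$, and put $$\hat v(x,a)=\sup_{c\in\mathcal C_a(x)}\int_0^\infty e^{-(\rho+\lambda)s}\left[U(c_s)+\lambda\int v(Y_s+az)\,p(dz)\right]ds .$$ Then for every $a\in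 A$: $\hat v(x,a)<\infty$ for all $x\ge l(a)$; the function $x\mapsto\hat v(x,a)$ is $C^1$ on $(l(a),+\infty)$; and $\lim_{x\downarrow l(a)}\frac{\partial\hat v}{\partial x}(x,a)=+\infty$. -/

import Mathlib

open MeasureTheory ProbabilityTheory Filter Topology Set
open scoped NNReal ENNReal

namespace Illiquid

/-- Assumptions on the utility function `U : ℝ₊ → ℝ` (values at negative arguments are never used):
strictly increasing, strictly concave, `C¹` on `(0, ∞)`, `U 0 = 0`, Inada conditions, and the growth
condition `U x ≤ K₁ x ^ γ` with `γ ∈ (0, 1)`. -/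
structure IsUtility (U : ℝ → ℝ) (γ K₁ : ℝ) : Prop where
  strictMono : StrictMonoOn U (Ici 0)
  strictConcave : StrictConcaveOn ℝ (Ici 0) U
  contDiff : ContDiffOn ℝ 1 U (Ioi 0)
  map_zero : U 0 = 0
  inada_zero : Tendsto (deriv U) (𝓝[>] 0) atTop
  inada_top : Tendsto (deriv U) atTop (𝓝 0)
  gamma_pos : 0 < γ
  gamma_lt_one : γ < 1
  K_pos : 0 < K₁
  growth : ∀ x, 0 ≤ x → U x ≤ K₁ * x ^ γ

/-- Assumptions on the (time independent) distribution `p` of the returns: the support is either an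
interval with interior `(-zlow, zbar)` or a finite set with least element `-zlow` and greatest
element `zbar`; the mean is nonnegative and `∫ (1 + z) p(dz) ≤ k e^{bt}` for all `t ≥ 0`. -/
structure IsReturnLaw (p : Measure ℝ) (zlow : ℝ) (zbar : EReal) (k b : ℝ) : Prop where
  isProbabilityMeasure : IsProbabilityMeasure p
  zlow_pos : 0 < zlow
  zlow_le_one : zlow ≤ 1
  zbar_pos : 0 < zbar
  support :
    (p.support.OrdConnected ∧
        interior p.support = {z : ℝ | -zlow < z ∧ (z : EReal) < zbar}) ∨
      (p.support.Finite ∧ IsLeast p.support (-zlow) ∧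
        ∃ M : ℝ, zbar = (M : EReal) ∧ IsGreatest p.support M)
  integrable : Integrable (fun z : ℝ => z) p
  mean_nonneg : 0 ≤ ∫ z, z ∂p
  k_nonneg : 0 ≤ k
  b_nonneg : 0 ≤ b
  growth : ∀ t : ℝ, 0 ≤ t → ∫ z, (1 + z) ∂p ≤ k * Real.exp (b * t)

/-- Trading dates `0 = τ₀ < τ₁ < ⋯` and observed returns `Z₁, Z₂, …` (`Z₀` is a fixed constant). -/
structure Market (Ω : Type*) [MeasurableSpace Ω] where
  τ : ℕ → Ω → ℝ≥0
  Z : ℕ → Ω → ℝ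
  measurable_τ : ∀ n, Measurable (τ n)
  measurable_Z : ∀ n, Measurable (Z n)
  τ_zero : ∀ ω, τ 0 ω = 0
  τ_lt : ∀ n ω, τ n ω < τ (n + 1) ω
  Z_zero : ∃ z₀ : ℝ, ∀ ω, Z 0 ω = z₀

namespace Market

variable {Ω : Type*} [mΩ : MeasurableSpace Ω]

/-- The pair formed by the `n + 1`-st interarrival time and the return observed at its end. -/
def step (M : Market Ω) (n : ℕ) (ω : Ω) : ℝ × ℝ :=
  ((M.τ (n + 1) ω : ℝ) - (M.τ n ω : ℝ), M.Z (n + 1) ω)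

/-- The trading dates are the jumps of a Poisson process of intensity `lam` and, given the
interarrival time, the return is independent of the past with distribution `p`: the pairs
(interarrival time, return) are i.i.d. with law `Exp(lam) ⊗ p`. -/
structure IsPoissonWith (M : Market Ω) (P : Measure Ω) (lam : ℝ) (p : Measure ℝ) : Prop where
  indep : iIndepFun M.step P
  law : ∀ n, P.map (M.step n) = (expMeasure lam).prod p

/-- The continuous observation filtration `𝒢_t = σ{(τ_k, Z_k) : τ_k ≤ t}`. -/
def obs (M : Market Ω) : Filtration ℝ≥0 mΩ where
  seq t := MeasurableSpace.generateFrom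
    {s | ∃ (n : ℕ) (u : ℝ≥0) (B : Set ℝ), u ≤ t ∧ MeasurableSet B ∧
      s = {ω | M.τ n ω ≤ u ∧ M.Z n ω ∈ B}}
  mono' := by
    intro s t hst
    apply MeasurableSpace.generateFrom_mono
    rintro _ ⟨n, u, B, hu, hB, rfl⟩
    exact ⟨n, u, B, hu.trans hst, hB, rfl⟩
  le' := by
    intro t
    apply MeasurableSpace.generateFrom_le
    rintro _ ⟨n, u, B, _, hB, rfl⟩
    exact (measurableSet_le (M.measurable_τ n) measurable_const).inter (M.measurable_Z n hB)

/-- Trading dates are stopping times of the observation filtration. -/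
theorem isStoppingTime_τ (M : Market Ω) (n : ℕ) :
    IsStoppingTime M.obs (fun ω => (M.τ n ω : WithTop ℝ≥0)) := by
  intro t
  apply MeasurableSpace.measurableSet_generateFrom
  refine ⟨n, t, univ, le_rfl, MeasurableSet.univ, ?_⟩
  ext ω
  simp only [mem_ofPred_eq, mem_univ, and_true]
  exact WithTop.coe_le_coe

/-- The wealth `X_n = x - ∫_0^{τ_n} c_t dt + ∑_{i=1}^n α_i Z_i`. -/
noncomputable def wealth (M : Market Ω) (x : ℝ) (α : ℕ → Ω → ℝ) (c : ℝ → Ω → ℝ) (n : ℕ) (ω : Ω) :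
    ℝ :=
  x - (∫ t in (0 : ℝ)..(M.τ n ω : ℝ), c t ω) + ∑ i ∈ Finset.Icc 1 n, α i ω * M.Z i ω

/-- Admissible policies `(α, c)` from the initial capital `x`: `α_k` is `𝒢_{τ_{k-1}}`-measurable for
`k ≥ 1`, `c` is nonnegative and predictable for the observation filtration (only times `t ≥ 0`
matter), and `X_n ≥ 0` a.s. for `n ≥ 1`. Integrability of `c` over `[0, τ_n]` is required, as
the wealth would be `-∞` without it. -/
structure Admissible (M : Market Ω) (P : Measure Ω) (x : ℝ) (α : ℕ → Ω → ℝ) (c : ℝ → Ω → ℝ) :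
    Prop where
  invest : ∀ n, Measurable[(M.isStoppingTime_τ n).measurableSpace] (α (n + 1))
  predictable : IsStronglyPredictable M.obs (fun (t : ℝ≥0) (ω : Ω) => c (t : ℝ) ω)
  nonneg : ∀ t ω, 0 ≤ t → 0 ≤ c t ω
  integrable : ∀ᵐ ω ∂P, ∀ n, IntervalIntegrable (fun t => c t ω) volume 0 (M.τ n ω)
  solvent : ∀ᵐ ω ∂P, ∀ n, 1 ≤ n → 0 ≤ M.wealth x α c n ω

/-- The value function `v(x) = sup_{(α, c) ∈ 𝒜(x)} E[∫_0^∞ e^{-ρ t} U(c_t) dt]`, valued in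
`[0, ∞]`. -/
noncomputable def value (M : Market Ω) (P : Measure Ω) (U : ℝ → ℝ) (ρ x : ℝ) : ℝ≥0∞ :=
  ⨆ (α : ℕ → Ω → ℝ) (c : ℝ → Ω → ℝ) (_ : M.Admissible P x α c),
    ∫⁻ ω, (∫⁻ t in Ioi (0 : ℝ), ENNReal.ofReal (Real.exp (-ρ * t) * U (c t ω))) ∂P

end Market

/-- The set `A` of investments: `ℝ` if `zbar < ∞`, and `ℝ₊` if `zbar = ∞`. -/
def investSet (zbar : EReal) : Set ℝ := {a | zbar = ⊤ → 0 ≤ a}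

open Classical in
/-- `l(a) = max (a zlow) (-a zbar)`, and `l(a) = a zlow` if `zbar = ∞`. -/
noncomputable def lowerWealth (zlow : ℝ) (zbar : EReal) (a : ℝ) : ℝ :=
  if zbar = ⊤ then a * zlow else max (a * zlow) (-a * zbar.toReal)

/-- `𝒞_a(x)`, with `l = l(a)`: deterministic nonnegative consumption rates with
`∫_0^t c ≤ x - l(a)` for all `t ≥ 0` (only times `t ≥ 0` matter). -/
structure DetAdmissible (l x : ℝ) (c : ℝ → ℝ) : Prop where
  measurable : Measurable c
  nonneg : ∀ t, 0 ≤ t → 0 ≤ c t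
  integrable : ∀ t, 0 ≤ t → IntervalIntegrable c volume 0 t
  budget : ∀ t, 0 ≤ t → ∫ u in (0 : ℝ)..t, c u ≤ x - l

/-- `g(x, a) = λ ∫ v(x + a z) p(dz)`. -/
noncomputable def gain (lam : ℝ) (p : Measure ℝ) (v : ℝ → ℝ≥0∞) (x a : ℝ) : ℝ≥0∞ :=
  ENNReal.ofReal lam * ∫⁻ z, v (x + a * z) ∂p

/-- The stationary auxiliary value function
`v̂(x, a) = sup_{c ∈ 𝒞_a(x)} ∫_0^∞ e^{-(ρ + λ) s} [U(c_s) + g(Y_s, a)] ds`, `Y_s = x - ∫_0^s c`,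
valued in `[0, ∞]`. -/
noncomputable def auxValue (U : ℝ → ℝ) (ρ lam zlow : ℝ) (zbar : EReal) (p : Measure ℝ)
    (v : ℝ → ℝ≥0∞) (x a : ℝ) : ℝ≥0∞ :=
  ⨆ (c : ℝ → ℝ) (_ : DetAdmissible (lowerWealth zlow zbar a) x c),
    ∫⁻ s in Ioi (0 : ℝ), ENNReal.ofReal (Real.exp (-(ρ + lam) * s)) *
      (ENNReal.ofReal (U (c s)) + gain lam p v (x - ∫ u in (0 : ℝ)..s, c u) a)

end Illiquid

/-! For fixed `a`, `vhat` is the value of a deterministic consumption problem with discount `β = ρ +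
lam` and running reward `g = gain`. The argument needs only that `g` is monotone, and finite and
concave on `[l, ∞)` (`IsReward`).

Finiteness of `g` comes from a growth bound `v(x) ≤ C x^γ` (`exists_value_le`). Until the next
trading date, the observed information is that of the past steps, while the next return is
independent of the past and of the waiting time. Hence solvency holds against every point of the
support of `p`. It bounds the investment by the wealth, so Jensen's inequality and the exponential
waiting time contract the discounted expectation of `wealth ^ γ` by the factor `lam / (lam + ρ) * (k
/ zlow) ^ γ` at each date. The discount condition makes this factor less than 1, and a geometric
series bounds the utility. Concavity of `v`, hence of `g`, holds because policies can be mixed.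

Let `W` be the deterministic value; it is finite, concave and monotone. A kink is excluded by an
elementary viscosity argument. If the left derivative `L` at `x` exceeded the right derivative `R`,
take `R < q < L` and `c₀` with `U'(c₀) = q`. The upper half of dynamic programming
(`detValue_le_of_superdiff`) gives `β W ≤ U c₀ - q c₀ + g`, and the lower half
(`supersolution_right`) gives `U c₀ + g ≤ β W + c₀ R`; together `q ≤ R`, a contradiction. A
differentiable concave function is `C¹` because its derivative is monotone and has the Darboux
property.

As `x ↓ l` little is left to consume, so `β W ≤ g + o(1)`. The lower inequality then yields `c₀ W' ≥
U c₀ - o(1)` for each `c₀ > 0`, and `U c₀ / c₀` is arbitrarily large for small `c₀`. -/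

namespace Illiquid

/-! ### Information available between consecutive trading dates. -/

namespace Market

variable {Ω : Type*} [mΩ : MeasurableSpace Ω]

/-- The first `n` steps of the market, padded by zeros. -/
def past (M : Market Ω) (n : ℕ) (ω : Ω) : ℕ → ℝ × ℝ :=
  fun i => if i < n then M.step i ω else 0

/-- The first `n` steps together with the next interarrival time. -/
def pastGap (M : Market Ω) (n : ℕ) (ω : Ω) : (ℕ → ℝ × ℝ) × ℝ :=
  (M.past n ω, (M.step n ω).1)

/-- The information carried by the first `n` steps. -/
abbrev pastSigma (M : Market Ω) (n : ℕ) : MeasurableSpace Ω :=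
  MeasurableSpace.comap (M.past n) inferInstance

/-- The information carried by the first `n` steps and the next interarrival time. -/
abbrev pastGapSigma (M : Market Ω) (n : ℕ) : MeasurableSpace Ω :=
  MeasurableSpace.comap (M.pastGap n) inferInstance

theorem measurable_step (M : Market Ω) (n : ℕ) : Measurable (M.step n) := by
  unfold step
  have h1 := M.measurable_τ (n + 1)
  have h2 := M.measurable_τ n
  have h3 := M.measurable_Z (n + 1)
  fun_prop

theorem measurable_past (M : Market Ω) (n : ℕ) : Measurable (M.past n) := by
  refine measurable_pi_lambda _ fun i => ?_
  unfold past
  by_cases h : i < n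
  · simpa [h] using M.measurable_step i
  · simp [h]

theorem measurable_pastGap (M : Market Ω) (n : ℕ) : Measurable (M.pastGap n) :=
  (M.measurable_past n).prodMk (M.measurable_step n).fst

theorem τ_strictMono (M : Market Ω) (ω : Ω) : StrictMono fun n => M.τ n ω :=
  strictMono_nat_of_lt_succ fun n => M.τ_lt n ω

theorem τ_eq_sum (M : Market Ω) (n : ℕ) (ω : Ω) :
    (M.τ n ω : ℝ) = ∑ i ∈ Finset.range n, (M.step i ω).1 := by
  simp only [step]
  rw [Finset.sum_range_sub (fun i => (M.τ i ω : ℝ))]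
  simp [M.τ_zero]

theorem τ_eq_sum_past (M : Market Ω) {m n : ℕ} (h : m ≤ n) (ω : Ω) :
    (M.τ m ω : ℝ) = ∑ i ∈ Finset.range m, (M.past n ω i).1 := by
  rw [τ_eq_sum]
  refine Finset.sum_congr rfl fun i hi => ?_
  have : i < n := (Finset.mem_range.1 hi).trans_le h
  simp [past, this]

theorem τ_succ_eq_pastGap (M : Market Ω) (n : ℕ) (ω : Ω) :
    (M.τ (n + 1) ω : ℝ) =
      ∑ i ∈ Finset.range n, ((M.pastGap n ω).1 i).1 + (M.pastGap n ω).2 := by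
  rw [τ_eq_sum, Finset.sum_range_succ, ← τ_eq_sum, M.τ_eq_sum_past le_rfl]
  rfl

theorem Z_eq_past (M : Market Ω) {m n : ℕ} (h : m < n) (ω : Ω) :
    M.Z (m + 1) ω = (M.past n ω m).2 := by
  simp [past, h, step]

theorem past_eq_truncate (M : Market Ω) {m n : ℕ} (h : m ≤ n) (ω : Ω) :
    M.past m ω = fun i => if i < m then M.past n ω i else 0 := by
  funext i
  by_cases hi : i < m
  · simp [past, hi, hi.trans_le h]
  · simp [past, hi]

theorem measurable_truncate (m : ℕ) :
    Measurable fun (s : ℕ → ℝ × ℝ) (i : ℕ) => if i < m then s i else 0 := by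
  refine measurable_pi_lambda _ fun i => ?_
  by_cases hi : i < m
  · simpa [hi] using measurable_pi_apply i
  · simp [hi]

theorem pastSigma_le_pastGapSigma (M : Market Ω) (n : ℕ) : M.pastSigma n ≤ M.pastGapSigma n := by
  rw [← measurable_iff_comap_le]
  have : M.past n = Prod.fst ∘ M.pastGap n := rfl
  rw [this]
  exact measurable_fst.comp (comap_measurable _)

theorem pastGapSigma_le_pastSigma (M : Market Ω) {m n : ℕ} (h : m < n) :
    M.pastGapSigma m ≤ M.pastSigma n := by
  rw [← measurable_iff_comap_le]
  have : M.pastGap m = (fun (s : ℕ → ℝ × ℝ) =>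
      ((fun i : ℕ => if i < m then s i else 0), (s m).1)) ∘ M.past n := by
    funext ω
    refine Prod.ext (M.past_eq_truncate h.le ω) ?_
    simp [pastGap, past, h]
  rw [this]
  exact ((measurable_truncate m).prodMk (measurable_pi_apply m).fst).comp (comap_measurable _)

/-- Before the date `τ (n + 1)` only the first `n` steps have been observed. The property is checked
on the generators of `obs` and is stable under complements and countable unions. -/
theorem obs_trace (M : Market Ω) (n : ℕ) (t : ℝ≥0) (A : Set Ω) (hA : MeasurableSet[M.obs t] A) :
    ∃ A' : Set (ℕ → ℝ × ℝ), MeasurableSet A' ∧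
      ∀ ω, t < M.τ (n + 1) ω → (ω ∈ A ↔ M.past n ω ∈ A') := by
  refine MeasurableSpace.generateFrom_induction _
    (fun A _ => ∃ A' : Set (ℕ → ℝ × ℝ), MeasurableSet A' ∧
      ∀ ω, t < M.τ (n + 1) ω → (ω ∈ A ↔ M.past n ω ∈ A')) ?_ ?_ ?_ ?_ A hA
  · rintro _ ⟨m, u, B, hu, hB, rfl⟩ -
    by_cases hm : m ≤ n
    · rcases m with _ | m
      -- For index 0 the generator is trivial, since `τ 0 = 0` and `Z 0` is constant.
      · obtain ⟨z₀, hz⟩ := M.Z_zero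
        by_cases h0 : z₀ ∈ B
        · exact ⟨univ, .univ, fun ω _ => by simp [hz, h0, M.τ_zero]⟩
        · exact ⟨∅, .empty, fun ω _ => by simp [hz, h0]⟩
      · refine ⟨{s | ∑ i ∈ Finset.range (m + 1), (s i).1 ≤ (u : ℝ)} ∩ {s | (s m).2 ∈ B}, ?_, ?_⟩
        · refine (measurableSet_le (Finset.measurable_sum _ fun i _ =>
            (measurable_pi_apply i).fst) measurable_const).inter ?_
          exact (measurable_pi_apply m).snd hB
        · intro ω _
          simp only [mem_inter_iff, mem_ofPred_eq, ← M.τ_eq_sum_past hm, ← M.Z_eq_past hm,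
            NNReal.coe_le_coe]
    -- A generator of index larger than `n` would require `τ (n + 1) ≤ u ≤ t`.
    · refine ⟨∅, .empty, fun ω hω => ?_⟩
      simp only [mem_ofPred_eq, mem_empty_iff_false, iff_false, not_and]
      intro h
      have := (M.τ_strictMono ω).monotone (show n + 1 ≤ m by omega)
      exact absurd (hω.trans_le (this.trans (h.trans hu))) (lt_irrefl _)
  · exact ⟨∅, .empty, fun _ _ => by simp⟩
  · rintro A - ⟨A', hA', h⟩
    exact ⟨A'ᶜ, hA'.compl, fun ω hω => not_congr (h ω hω)⟩
  · intro s _ h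
    choose A' hA' h using h
    refine ⟨⋃ i, A' i, .iUnion hA', fun ω hω => ?_⟩
    simp only [mem_iUnion, h _ ω hω]

/-- A rational `q` with `τ n ≤ q < τ (n + 1)` reduces the event to its trace at the deterministic
time `q`. Testing `q < τ (n + 1)` involves the next gap, whence `pastGapSigma`; this is harmless
because the next return is independent of the gap too. -/
theorem stopping_le_pastGapSigma (M : Market Ω) (n : ℕ) :
    (M.isStoppingTime_τ n).measurableSpace ≤ M.pastGapSigma n := by
  intro A hA
  have h2 : ∀ q : ℚ, ∃ A' : Set (ℕ → ℝ × ℝ), MeasurableSet A' ∧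
      ∀ ω, Real.toNNReal q < M.τ (n + 1) ω →
        (ω ∈ A ∩ {ω | (M.τ n ω : WithTop ℝ≥0) ≤ ((Real.toNNReal q : ℝ≥0) : WithTop ℝ≥0)} ↔ M.past n ω ∈ A') :=
    fun q => M.obs_trace n _ _ (hA.2 _)
  choose A' hA' h using h2
  refine ⟨⋃ q : ℚ, (Prod.fst ⁻¹' A' q) ∩
    {s | (Real.toNNReal q : ℝ) < ∑ i ∈ Finset.range n, (s.1 i).1 + s.2}, ?_, ?_⟩
  · refine .iUnion fun q => (measurable_fst (hA' q)).inter (measurableSet_lt measurable_const ?_)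
    exact (Finset.measurable_sum _ fun i _ =>
      ((measurable_pi_apply i).comp measurable_fst).fst).add measurable_snd
  · ext ω
    simp only [mem_preimage, mem_iUnion, mem_inter_iff, mem_ofPred_eq, ← M.τ_succ_eq_pastGap,
      NNReal.coe_lt_coe]
    constructor
    · rintro ⟨q, h1, h3⟩
      exact ((h q ω h3).2 h1).1
    · intro hω
      obtain ⟨q, -, hq1, hq2⟩ := (NNReal.lt_iff_exists_rat_btwn _ _).1 (M.τ_lt n ω)
      exact ⟨q, (h q ω hq2).1 ⟨hω, WithTop.coe_le_coe.2 hq1.le⟩, hq2⟩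

/-- A generator `(s, ∞) × A` with `A ∈ 𝒢_s`, restricted to `t ≤ τ (n + 1)`, only meets points with
`s < τ (n + 1)`, so `obs_trace` applies. The process then factors through `(t, past)` by the
Doob-Dynkin lemma. -/
theorem predictable_eq_past (M : Market Ω) {c : ℝ → Ω → ℝ}
    (hc : IsStronglyPredictable M.obs (fun (t : ℝ≥0) (ω : Ω) => c (t : ℝ) ω)) (n : ℕ) :
    ∃ c' : ℝ≥0 × (ℕ → ℝ × ℝ) → ℝ, Measurable c' ∧
      ∀ (t : ℝ≥0) (ω : Ω), t ≤ M.τ (n + 1) ω → c t ω = c' (t, M.past n ω) := by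
  let D : Set (ℝ≥0 × Ω) := {q | q.1 ≤ M.τ (n + 1) q.2}
  let φ : D → ℝ≥0 × (ℕ → ℝ × ℝ) := fun q => (q.1.1, M.past n q.1.2)
  have hle : MeasurableSpace.comap (Subtype.val : D → ℝ≥0 × Ω) M.obs.predictable ≤
      MeasurableSpace.comap φ inferInstance := by
    rw [Filtration.predictable, MeasurableSpace.comap_generateFrom]
    refine MeasurableSpace.generateFrom_le ?_
    rintro _ ⟨_, ⟨A, hA, rfl⟩ | ⟨t, A, hA, rfl⟩, rfl⟩
    · obtain ⟨A', hA', h⟩ := M.obs_trace n _ A hA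
      refine ⟨{⊥} ×ˢ A', (measurableSet_singleton _).prod hA', ?_⟩
      ext ⟨⟨u, ω⟩, hu⟩
      have : (⊥ : ℝ≥0) < M.τ (n + 1) ω := lt_of_le_of_lt bot_le (M.τ_lt n ω)
      simp [φ, h ω this]
    · obtain ⟨A', hA', h⟩ := M.obs_trace n _ A hA
      refine ⟨Ioi t ×ˢ A', measurableSet_Ioi.prod hA', ?_⟩
      ext ⟨⟨u, ω⟩, hu⟩
      simp only [φ, mem_preimage, mem_prod, mem_Ioi]
      refine and_congr_right fun htu => (h ω (lt_of_lt_of_le htu hu)).symm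
  have hm : Measurable[MeasurableSpace.comap φ inferInstance]
      (fun q : D => c (q.1.1 : ℝ) q.1.2) := by
    have h1 : Measurable[MeasurableSpace.comap (Subtype.val : D → ℝ≥0 × Ω) M.obs.predictable]
        (fun q : D => c (q.1.1 : ℝ) q.1.2) :=
      (StronglyMeasurable.measurable hc).comp (comap_measurable _)
    exact h1.mono hle le_rfl
  obtain ⟨c', hc', h⟩ := hm.exists_eq_measurable_comp
  exact ⟨c', hc', fun t ω ht => congrFun h ⟨(t, ω), ht⟩⟩

end Market

/-! ### Measurability of the wealth and independence of the next step. -/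

namespace Market

variable {Ω : Type*} [mΩ : MeasurableSpace Ω]

/-- The wealth just before the return observed at the date `τ (n + 1)`, without the investment
made at `τ n`. -/
noncomputable def preWealth (M : Market Ω) (x : ℝ) (α : ℕ → Ω → ℝ) (c : ℝ → Ω → ℝ) (n : ℕ)
    (ω : Ω) : ℝ :=
  x - (∫ t in (0 : ℝ)..(M.τ (n + 1) ω : ℝ), c t ω) + ∑ i ∈ Finset.Icc 1 n, α i ω * M.Z i ω

theorem wealth_succ (M : Market Ω) (x : ℝ) (α : ℕ → Ω → ℝ) (c : ℝ → Ω → ℝ) (n : ℕ) (ω : Ω) :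
    M.wealth x α c (n + 1) ω =
      M.preWealth x α c n ω + α (n + 1) ω * (M.step n ω).2 := by
  rw [wealth, preWealth, Finset.sum_Icc_succ_top (by omega), step]
  ring

theorem wealth_zero (M : Market Ω) (x : ℝ) (α : ℕ → Ω → ℝ) (c : ℝ → Ω → ℝ) (ω : Ω) :
    M.wealth x α c 0 ω = x := by
  simp [wealth, M.τ_zero]

theorem preWealth_eq (M : Market Ω) {x : ℝ} {α : ℕ → Ω → ℝ} {c : ℝ → Ω → ℝ} {n : ℕ} {ω : Ω}
    (h : ∀ m, IntervalIntegrable (fun t => c t ω) volume 0 (M.τ m ω)) :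
    M.preWealth x α c n ω =
      M.wealth x α c n ω - ∫ t in (M.τ n ω : ℝ)..(M.τ (n + 1) ω : ℝ), c t ω := by
  rw [wealth, preWealth, ← intervalIntegral.integral_interval_sub_left (h (n + 1)) (h n)]
  ring

/-- Up to `τ (n + 1)` the rate is a function of time and the past, and the endpoint is a function of
the past and the gap. The integral is thus a parametrised integral of the jointly measurable cut-off
`f`. -/
theorem measurable_integral_consumption (M : Market Ω) {c : ℝ → Ω → ℝ}
    (hc : IsStronglyPredictable M.obs (fun (t : ℝ≥0) (ω : Ω) => c (t : ℝ) ω)) (n : ℕ) :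
    Measurable[M.pastGapSigma n] fun ω => ∫ t in (0 : ℝ)..(M.τ (n + 1) ω : ℝ), c t ω := by
  obtain ⟨c', hc', h⟩ := M.predictable_eq_past hc n
  let T : (ℕ → ℝ × ℝ) × ℝ → ℝ := fun s => ∑ i ∈ Finset.range n, (s.1 i).1 + s.2
  have hT : Measurable T := (Finset.measurable_sum _ fun i _ =>
    ((measurable_pi_apply i).comp measurable_fst).fst).add measurable_snd
  let f : ((ℕ → ℝ × ℝ) × ℝ) × ℝ → ℝ :=
    {q | 0 < q.2 ∧ q.2 ≤ T q.1}.indicator fun q => c' (q.2.toNNReal, q.1.1)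
  have hf : Measurable f := by
    refine Measurable.indicator ?_ ?_
    · exact hc'.comp ((measurable_real_toNNReal.comp measurable_snd).prodMk
        measurable_fst.fst)
    · exact (measurableSet_lt measurable_const measurable_snd).inter
        (measurableSet_le measurable_snd (hT.comp measurable_fst))
  have hG : Measurable fun s => ∫ t, f (s, t) :=
    (hf.stronglyMeasurable.integral_prod_right' (ν := volume)).measurable
  have heq : (fun ω => ∫ t in (0 : ℝ)..(M.τ (n + 1) ω : ℝ), c t ω) =
      (fun s => ∫ t, f (s, t)) ∘ M.pastGap n := by
    funext ω
    rw [intervalIntegral.integral_of_le (NNReal.coe_nonneg _),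
      ← integral_indicator measurableSet_Ioc]
    simp only [Function.comp]
    congr 1
    funext t
    have hTω : T (M.pastGap n ω) = M.τ (n + 1) ω := (M.τ_succ_eq_pastGap n ω).symm
    by_cases ht : 0 < t ∧ t ≤ M.τ (n + 1) ω
    · have h1 := h t.toNNReal ω (by
        rw [← NNReal.coe_le_coe, Real.coe_toNNReal _ ht.1.le]; exact ht.2)
      rw [Real.coe_toNNReal _ ht.1.le] at h1
      simp only [f]
      rw [indicator_of_mem (by exact ht),
        indicator_of_mem (by rw [mem_ofPred_eq, hTω]; exact ht), h1]
      rfl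
    · simp only [f]
      rw [indicator_of_notMem (by exact ht),
        indicator_of_notMem (by rw [mem_ofPred_eq, hTω]; exact ht)]
  rw [heq]
  exact hG.comp (comap_measurable _)

theorem measurable_sum_invest (M : Market Ω) {α : ℕ → Ω → ℝ}
    (hα : ∀ n, Measurable[(M.isStoppingTime_τ n).measurableSpace] (α (n + 1))) (n : ℕ) :
    Measurable[M.pastSigma n] fun ω => ∑ i ∈ Finset.Icc 1 n, α i ω * M.Z i ω := by
  refine Finset.measurable_sum _ fun i hi => ?_
  obtain ⟨j, rfl⟩ : ∃ j, i = j + 1 := ⟨i - 1, by have := (Finset.mem_Icc.1 hi).1; omega⟩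
  have hj : j < n := by have := (Finset.mem_Icc.1 hi).2; omega
  have h1 : Measurable[M.pastSigma n] (α (j + 1)) :=
    (hα j).mono ((M.stopping_le_pastGapSigma j).trans (M.pastGapSigma_le_pastSigma hj)) le_rfl
  have h2 : Measurable[M.pastSigma n] (M.Z (j + 1)) := by
    have : M.Z (j + 1) = (fun s : ℕ → ℝ × ℝ => (s j).2) ∘ M.past n :=
      funext fun ω => M.Z_eq_past hj ω
    rw [this]
    exact (measurable_pi_apply j).snd.comp (comap_measurable _)
  exact h1.mul h2

variable {M : Market Ω} {P : Measure Ω} {x : ℝ} {α : ℕ → Ω → ℝ} {c : ℝ → Ω → ℝ}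

theorem Admissible.measurable_invest (h : M.Admissible P x α c) (n : ℕ) :
    Measurable[M.pastGapSigma n] (α (n + 1)) :=
  (h.invest n).mono (M.stopping_le_pastGapSigma n) le_rfl

theorem Admissible.measurable_preWealth (h : M.Admissible P x α c) (n : ℕ) :
    Measurable[M.pastGapSigma n] (M.preWealth x α c n) :=
  (measurable_const.sub (M.measurable_integral_consumption h.predictable n)).add
    ((M.measurable_sum_invest h.invest n).mono (M.pastSigma_le_pastGapSigma n) le_rfl)

theorem Admissible.measurable_wealth (h : M.Admissible P x α c) (n : ℕ) :
    Measurable[M.pastSigma n] (M.wealth x α c n) := by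
  refine (measurable_const.sub ?_).add (M.measurable_sum_invest h.invest n)
  rcases n with _ | n
  · simp only [M.τ_zero, NNReal.coe_zero, intervalIntegral.integral_same]
    exact measurable_const
  · exact (M.measurable_integral_consumption h.predictable n).mono
      (M.pastGapSigma_le_pastSigma n.lt_succ_self) le_rfl

variable [IsProbabilityMeasure P] {lam : ℝ} {p : Measure ℝ}

theorem IsPoissonWith.map_past_step (hM : M.IsPoissonWith P lam p) (n : ℕ) :
    P.map (fun ω => (M.past n ω, M.step n ω)) =
      (P.map (M.past n)).prod ((expMeasure lam).prod p) := by
  have h1 := hM.indep.indepFun_finset (Finset.range n) {n} (by simp) M.measurable_step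
  have h2 : IndepFun (M.past n) (M.step n) P := by
    refine h1.comp (φ := fun s i => if hi : i < n then s ⟨i, Finset.mem_range.2 hi⟩ else 0)
      (ψ := fun s => s ⟨n, by simp⟩) ?_ ?_
    · refine measurable_pi_lambda _ fun i => ?_
      by_cases hi : i < n
      · simpa [hi] using measurable_pi_apply _
      · simp [hi]
    · exact measurable_pi_apply _
  rw [← hM.law n]
  exact h2.map_prod_eq_prod_map_map (M.measurable_past n).aemeasurable
    (M.measurable_step n).aemeasurable

theorem IsPoissonWith.map_pastGap_Z [SFinite p] (hlam : 0 < lam) (hM : M.IsPoissonWith P lam p)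
    (n : ℕ) :
    P.map (fun ω => (M.pastGap n ω, (M.step n ω).2)) =
      ((P.map (M.past n)).prod (expMeasure lam)).prod p := by
  have := isProbabilityMeasure_expMeasure hlam
  have := Measure.isProbabilityMeasure_map (μ := P) (M.measurable_past n).aemeasurable
  have h := hM.map_past_step n
  rw [← Measure.prodAssoc_prod] at h
  apply MeasurableEquiv.prodAssoc.map_measurableEquiv_injective
  rw [← h, Measure.map_map MeasurableEquiv.prodAssoc.measurable
    ((M.measurable_pastGap n).prodMk (M.measurable_step n).snd)]
  rfl

theorem IsPoissonWith.map_pastGap [IsProbabilityMeasure p] (hlam : 0 < lam)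
    (hM : M.IsPoissonWith P lam p) (n : ℕ) :
    P.map (M.pastGap n) = (P.map (M.past n)).prod (expMeasure lam) := by
  have := isProbabilityMeasure_expMeasure hlam
  have := Measure.isProbabilityMeasure_map (μ := P) (M.measurable_past n).aemeasurable
  have h := congrArg (Measure.map Prod.fst) (hM.map_pastGap_Z hlam n)
  rw [Measure.map_map measurable_fst
    ((M.measurable_pastGap n).prodMk (M.measurable_step n).snd), Measure.map_fst_prod,
    measure_univ, one_smul] at h
  exact h

theorem IsPoissonWith.map_pastGap_Z' [IsProbabilityMeasure p] (hlam : 0 < lam)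
    (hM : M.IsPoissonWith P lam p) (n : ℕ) :
    P.map (fun ω => (M.pastGap n ω, (M.step n ω).2)) = (P.map (M.pastGap n)).prod p := by
  rw [hM.map_pastGap_Z hlam, hM.map_pastGap hlam]

end Market

/-! ### Support of the return law, and the Jensen bound for one period. -/

theorem IsReturnLaw.mem_support_bounds {p : Measure ℝ} {zlow : ℝ} {zbar : EReal} {k b : ℝ}
    (hp : IsReturnLaw p zlow zbar k b) {z : ℝ} (hz : z ∈ p.support) :
    -zlow ≤ z ∧ (z : EReal) ≤ zbar := by
  rcases hp.support with ⟨hoc, hint⟩ | ⟨-, hl, m, rfl, hg⟩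
  · have h0 : (0 : ℝ) ∈ p.support :=
      interior_subset (hint ▸ ⟨neg_neg_of_pos hp.zlow_pos, by exact_mod_cast hp.zbar_pos⟩)
    constructor
    · by_contra! h
      have hmem : z < -zlow ∧ -zlow < 0 := ⟨h, neg_neg_of_pos hp.zlow_pos⟩
      -- A support point below `-zlow` would, by order connectedness with `0`, put this midpoint in
      -- the interior of the support.
      have : (z + -zlow) / 2 ∈ interior p.support := by
        refine interior_maximal (Ioo_subset_Icc_self.trans (hoc.out hz h0)) isOpen_Ioo ?_
        constructor <;> linarith
      rw [hint] at this
      linarith [this.1]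
    · by_contra! h
      obtain ⟨y, hy1, hy2⟩ := EReal.lt_iff_exists_real_btwn.1 h
      have hy0 : 0 < y := by exact_mod_cast hp.zbar_pos.trans hy1
      have hyz : y < z := by exact_mod_cast hy2
      have : y ∈ interior p.support :=
        interior_maximal (Ioo_subset_Icc_self.trans (hoc.out h0 hz)) isOpen_Ioo ⟨hy0, hyz⟩
      rw [hint] at this
      exact absurd this.2 hy1.not_gt
  · exact ⟨hl.2 hz, by exact_mod_cast hg.2 hz⟩

theorem IsReturnLaw.neg_zlow_mem_support {p : Measure ℝ} {zlow : ℝ} {zbar : EReal} {k b : ℝ}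
    (hp : IsReturnLaw p zlow zbar k b) : -zlow ∈ p.support := by
  rcases hp.support with ⟨-, hint⟩ | ⟨-, hl, -⟩
  · have h : Ioo (-zlow) 0 ⊆ p.support := fun y hy => interior_subset (hint ▸
      ⟨hy.1, lt_trans (by exact_mod_cast hy.2) hp.zbar_pos⟩)
    have h1 : closure (Ioo (-zlow) 0) ⊆ p.support :=
      closure_minimal h p.isClosed_support
    rw [closure_Ioo (neg_neg_of_pos hp.zlow_pos).ne] at h1
    exact h1 ⟨le_rfl, (neg_neg_of_pos hp.zlow_pos).le⟩
  · exact hl.1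

theorem IsReturnLaw.exists_pos_mem_support {p : Measure ℝ} {zlow : ℝ} {zbar : EReal} {k b : ℝ}
    (hp : IsReturnLaw p zlow zbar k b) : ∃ z ∈ p.support, 0 < z := by
  rcases hp.support with ⟨-, hint⟩ | ⟨-, -, m, hm, hg⟩
  · obtain ⟨y, hy1, hy2⟩ := EReal.lt_iff_exists_real_btwn.1 hp.zbar_pos
    have hy0 : 0 < y := by exact_mod_cast hy1
    exact ⟨y, interior_subset (hint ▸ ⟨by linarith [hp.zlow_pos], hy2⟩), hy0⟩
  · exact ⟨m, hg.1, by have := hp.zbar_pos; rw [hm] at this; exact_mod_cast this⟩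

theorem ae_mem_support (p : Measure ℝ) : ∀ᵐ z ∂p, z ∈ p.support := p.support_mem_ae

/-- The constraint set is closed and of full measure, so it contains the support. -/
theorem nonneg_on_support {p : Measure ℝ} {a b : ℝ} (h : ∀ᵐ z ∂p, 0 ≤ a + b * z) :
    ∀ z ∈ p.support, 0 ≤ a + b * z :=
  fun _ hz => Measure.support_subset_of_isClosed
    (isClosed_le continuous_const (by fun_prop)) h hz

theorem IsReturnLaw.one_le_k {p : Measure ℝ} {zlow : ℝ} {zbar : EReal} {k b : ℝ}
    (hp : IsReturnLaw p zlow zbar k b) : 1 + ∫ z, z ∂p ≤ k := by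
  have := hp.isProbabilityMeasure
  have h := hp.growth 0 le_rfl
  rw [integral_add (integrable_const _) hp.integrable] at h
  simpa using h

theorem integral_affine {p : Measure ℝ} [IsProbabilityMeasure p]
    (hp : Integrable (fun z : ℝ => z) p) (a b : ℝ) :
    ∫ z, (a + b * z) ∂p = a + b * ∫ z, z ∂p := by
  rw [integral_add (integrable_const _) (hp.const_mul b), integral_const_mul]
  simp

/-- Solvency against every return in the support bounds the wealth and the investment. -/
theorem IsReturnLaw.solvent_bounds {p : Measure ℝ} {zlow : ℝ} {zbar : EReal} {k b : ℝ}
    (hp : IsReturnLaw p zlow zbar k b) {y a w : ℝ} (hy : ∀ z ∈ p.support, 0 ≤ y + a * z)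
    (hyw : y ≤ w) : 0 ≤ y ∧ y + a * ∫ z, z ∂p ≤ k / zlow * w := by
  have hz := hp.zlow_pos
  have hk := hp.one_le_k
  have h1 := hy _ hp.neg_zlow_mem_support
  obtain ⟨ζ, hζ, hζ0⟩ := hp.exists_pos_mem_support
  have h2 := hy _ hζ
  have h0 : 0 ≤ y := by
    -- A long position is tested against the return `-zlow`, a short one against the positive return
    -- `ζ`.
    rcases le_total 0 a with ha | ha
    · nlinarith
    · nlinarith
  refine ⟨h0, ?_⟩
  rw [div_mul_eq_mul_div, le_div_iff₀ hz]
  have hm := hp.mean_nonneg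
  -- Solvency at `-zlow` reads `a * zlow ≤ y`; this is the origin of the factor `1 / zlow` in the
  -- bound.
  have h3 : a * zlow * ∫ z, z ∂p ≤ y * ∫ z, z ∂p := by
    apply mul_le_mul_of_nonneg_right _ hm
    linarith
  have h4 : y * zlow ≤ y * 1 := mul_le_mul_of_nonneg_left hp.zlow_le_one h0
  have h5 : y * (1 + ∫ z, z ∂p) ≤ w * k := by
    apply mul_le_mul hyw hk (by linarith) (h0.trans hyw)
  nlinarith

theorem rpow_le_one_add {γ : ℝ} (h0 : 0 < γ) (h1 : γ < 1) {y : ℝ} (hy : 0 ≤ y) :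
    y ^ γ ≤ 1 + y := by
  rcases le_total y 1 with h | h
  · linarith [Real.rpow_le_one hy h h0.le]
  · have := Real.rpow_le_rpow_of_exponent_le h h1.le
    rw [Real.rpow_one] at this
    linarith

/-- Jensen's inequality for the concave power reduces the claim to the mean `y + a ∫ z`, which
`solvent_bounds` controls. -/
theorem IsReturnLaw.lintegral_rpow_le {p : Measure ℝ} {zlow : ℝ} {zbar : EReal} {k b : ℝ}
    (hp : IsReturnLaw p zlow zbar k b) {γ : ℝ} (hγ0 : 0 < γ) (hγ1 : γ < 1) {y a w : ℝ}
    (hy : ∀ z ∈ p.support, 0 ≤ y + a * z) (hyw : y ≤ w) :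
    ∫⁻ z, ENNReal.ofReal ((y + a * z) ^ γ) ∂p ≤ ENNReal.ofReal ((k / zlow * w) ^ γ) := by
  have := hp.isProbabilityMeasure
  have hpos : ∀ᵐ z ∂p, 0 ≤ y + a * z := (ae_mem_support p).mono hy
  have hint : Integrable (fun z => y + a * z) p :=
    (integrable_const _).add (hp.integrable.const_mul a)
  have hcont : Continuous fun t : ℝ => t ^ γ := Real.continuous_rpow_const hγ0.le
  have hint' : Integrable (fun z => (y + a * z) ^ γ) p := by
    refine ((integrable_const (1 : ℝ)).add hint).mono'
      ((hcont.comp (by fun_prop)).aestronglyMeasurable) ?_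
    filter_upwards [hpos] with z hz
    rw [Real.norm_of_nonneg (Real.rpow_nonneg hz _)]
    exact rpow_le_one_add hγ0 hγ1 hz
  rw [← ofReal_integral_eq_lintegral_ofReal hint'
    (hpos.mono fun z hz => Real.rpow_nonneg hz _)]
  apply ENNReal.ofReal_le_ofReal
  have hJ := (Real.concaveOn_rpow hγ0.le hγ1.le).le_map_integral hcont.continuousOn isClosed_Ici
    hpos hint hint'
  refine hJ.trans ?_
  simp only [integral_affine hp.integrable]
  refine Real.rpow_le_rpow ?_ (hp.solvent_bounds hy hyw).2 hγ0.le
  rw [← integral_affine hp.integrable]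
  exact integral_nonneg_of_ae hpos

/-! ### Discount integrals and the utility of a bounded total consumption. -/

theorem lintegral_exp_Ioi {β : ℝ} (hβ : 0 < β) (s : ℝ) :
    ∫⁻ t in Ioi s, ENNReal.ofReal (Real.exp (-β * t)) =
      ENNReal.ofReal (Real.exp (-β * s) / β) := by
  rw [← ofReal_integral_eq_lintegral_ofReal (integrableOn_exp_mul_Ioi (neg_neg_of_pos hβ) s)
    (ae_of_all _ fun t => (Real.exp_pos _).le), integral_exp_mul_Ioi (neg_neg_of_pos hβ)]
  congr 1
  field_simp

theorem lintegral_exp_expMeasure {lam ρ : ℝ} (hlam : 0 < lam) (hρ : 0 < ρ) :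
    ∫⁻ t, ENNReal.ofReal (Real.exp (-ρ * t)) ∂(expMeasure lam) =
      ENNReal.ofReal (lam / (lam + ρ)) := by
  have hpdf : expMeasure lam = volume.withDensity (exponentialPDF lam) := rfl
  have hm : Measurable (exponentialPDF lam) := (measurable_exponentialPDFReal lam).ennreal_ofReal
  rw [hpdf, lintegral_withDensity_eq_lintegral_mul _ hm (by fun_prop),
    ← lintegral_add_compl _ (measurableSet_Ici (a := (0 : ℝ)))]
  have h1 : ∫⁻ t in (Ici (0 : ℝ))ᶜ, (exponentialPDF lam *
      fun t => ENNReal.ofReal (Real.exp (-ρ * t))) t = 0 := by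
    rw [setLIntegral_congr_fun (g := 0) measurableSet_Ici.compl]
    · simp
    · intro t ht
      simp [exponentialPDF_of_neg (not_le.1 ht)]
  have h2 : ∫⁻ t in Ici (0 : ℝ), (exponentialPDF lam *
      fun t => ENNReal.ofReal (Real.exp (-ρ * t))) t =
      ∫⁻ t in Ici (0 : ℝ), ENNReal.ofReal lam * ENNReal.ofReal (Real.exp (-(lam + ρ) * t)) := by
    refine setLIntegral_congr_fun measurableSet_Ici fun t ht => ?_
    simp only [Pi.mul_apply]
    rw [exponentialPDF_of_nonneg ht, ← ENNReal.ofReal_mul (by positivity),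
      ← ENNReal.ofReal_mul hlam.le, mul_assoc, ← Real.exp_add]
    ring_nf
  rw [h1, h2, add_zero, lintegral_const_mul _ (by fun_prop),
    setLIntegral_congr Ioi_ae_eq_Ici.symm, lintegral_exp_Ioi (by positivity),
    ← ENNReal.ofReal_mul hlam.le]
  simp [div_eq_mul_inv]

theorem IsUtility.nonneg {U : ℝ → ℝ} {γ K₁ : ℝ} (hU : IsUtility U γ K₁) {y : ℝ} (hy : 0 ≤ y) :
    0 ≤ U y := by
  rw [← hU.map_zero]
  exact hU.strictMono.monotoneOn self_mem_Ici hy hy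

/-- Consuming at most `w` after the date `s` yields a discounted utility of order `w ^ γ`. -/
theorem IsUtility.lintegral_le {U : ℝ → ℝ} {γ K₁ : ℝ} (hU : IsUtility U γ K₁) {β s w : ℝ}
    (hβ : 0 < β) (hw : 0 ≤ w) {E : Set ℝ} (hE : MeasurableSet E) (hEs : E ⊆ Ioi s) {c : ℝ → ℝ}
    (hc : AEMeasurable c (volume.restrict E)) (hc0 : ∀ t ∈ E, 0 ≤ c t)
    (hcw : ∫⁻ t in E, ENNReal.ofReal (c t) ≤ ENNReal.ofReal w) :
    ∫⁻ t in E, ENNReal.ofReal (Real.exp (-β * t) * U (c t)) ≤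
      ENNReal.ofReal (K₁ * (1 + 1 / β)) * (ENNReal.ofReal (Real.exp (-β * s)) *
        ENNReal.ofReal (w ^ γ)) := by
  have hγ := hU.gamma_pos
  have hγ1 := hU.gamma_lt_one
  have hK := hU.K_pos
  -- With `w = 0` the consumption vanishes almost everywhere; the scaling by `w` below needs `w >
  -- 0`.
  rcases hw.eq_or_lt with rfl | hw
  · have h0 : ∫⁻ t in E, ENNReal.ofReal (c t) = 0 := by simpa using hcw
    rw [lintegral_eq_zero_iff' hc.ennreal_ofReal] at h0
    have h1 : ∫⁻ t in E, ENNReal.ofReal (Real.exp (-β * t) * U (c t)) = 0 := by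
      rw [← lintegral_zero (μ := volume.restrict E)]
      refine lintegral_congr_ae ?_
      filter_upwards [h0, ae_restrict_mem hE] with t ht htE
      have : c t = 0 := le_antisymm (by simpa using ht) (hc0 t htE)
      simp [this, hU.map_zero]
    rw [h1]
    exact zero_le
  · have hpt : ∀ t ∈ E, ENNReal.ofReal (Real.exp (-β * t) * U (c t)) ≤
        ENNReal.ofReal (K₁ * w ^ (γ - 1) * Real.exp (-β * s)) * ENNReal.ofReal (c t) +
          ENNReal.ofReal (K₁ * w ^ γ) * ENNReal.ofReal (Real.exp (-β * t)) := by
      intro t ht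
      have hct := hc0 t ht
      rw [← ENNReal.ofReal_mul (by positivity), ← ENNReal.ofReal_mul (by positivity),
        ← ENNReal.ofReal_add (by positivity) (by positivity)]
      apply ENNReal.ofReal_le_ofReal
      -- This is `r ^ γ ≤ 1 + r` at `r = c t / w`. After integration both terms are of order `w ^
      -- γ`, the first through the budget and the second through the discount.
      have hyoung : c t ^ γ ≤ w ^ (γ - 1) * c t + w ^ γ := by
        have h1 : c t ^ γ = w ^ γ * (c t / w) ^ γ := by
          rw [Real.div_rpow hct hw.le]
          field_simp
        rw [h1, Real.rpow_sub hw, Real.rpow_one]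
        have h2 := rpow_le_one_add hγ hγ1 (div_nonneg hct hw.le)
        calc w ^ γ * (c t / w) ^ γ ≤ w ^ γ * (1 + c t / w) := by gcongr
          _ = _ := by ring
      have hexp : Real.exp (-β * t) ≤ Real.exp (-β * s) := by
        apply Real.exp_le_exp.2
        have : s < t := hEs ht
        nlinarith
      calc Real.exp (-β * t) * U (c t)
          ≤ Real.exp (-β * t) * (K₁ * (w ^ (γ - 1) * c t + w ^ γ)) := by
            gcongr
            exact (hU.growth _ hct).trans (by gcongr)
        _ = K₁ * w ^ (γ - 1) * Real.exp (-β * t) * c t + K₁ * w ^ γ * Real.exp (-β * t) := by ring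
        _ ≤ _ := by gcongr
    calc ∫⁻ t in E, ENNReal.ofReal (Real.exp (-β * t) * U (c t))
        ≤ ∫⁻ t in E, (ENNReal.ofReal (K₁ * w ^ (γ - 1) * Real.exp (-β * s)) * ENNReal.ofReal (c t) +
          ENNReal.ofReal (K₁ * w ^ γ) * ENNReal.ofReal (Real.exp (-β * t))) :=
          setLIntegral_mono' hE hpt
      _ = ENNReal.ofReal (K₁ * w ^ (γ - 1) * Real.exp (-β * s)) * (∫⁻ t in E, ENNReal.ofReal (c t))
          + ENNReal.ofReal (K₁ * w ^ γ) * ∫⁻ t in E, ENNReal.ofReal (Real.exp (-β * t)) := by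
          rw [lintegral_add_right _ (by fun_prop), lintegral_const_mul' _ _ ENNReal.ofReal_ne_top,
            lintegral_const_mul' _ _ ENNReal.ofReal_ne_top]
      _ ≤ ENNReal.ofReal (K₁ * w ^ (γ - 1) * Real.exp (-β * s)) * ENNReal.ofReal w
          + ENNReal.ofReal (K₁ * w ^ γ) * ENNReal.ofReal (Real.exp (-β * s) / β) := by
          rw [← lintegral_exp_Ioi hβ]
          gcongr
      _ = _ := by
          rw [← ENNReal.ofReal_mul (by positivity), ← ENNReal.ofReal_mul (by positivity),
            ← ENNReal.ofReal_mul (by positivity), ← ENNReal.ofReal_mul (by positivity),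
            ← ENNReal.ofReal_add (by positivity) (by positivity), Real.rpow_sub hw, Real.rpow_one]
          congr 1
          field_simp

/-! ### Growth bound for the value function. -/

namespace Market

variable {Ω : Type*} [mΩ : MeasurableSpace Ω] {M : Market Ω} {P : Measure Ω}
  {x : ℝ} {α : ℕ → Ω → ℝ} {c : ℝ → Ω → ℝ}

/-- The discount factor at the `n`-th trading date. -/
noncomputable def discount (M : Market Ω) (ρ : ℝ) (n : ℕ) (ω : Ω) : ℝ≥0∞ :=
  ENNReal.ofReal (Real.exp (-ρ * (M.τ n ω : ℝ)))

theorem measurable_discount (M : Market Ω) (ρ : ℝ) (n : ℕ) : Measurable (M.discount ρ n) := by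
  have := M.measurable_τ n
  unfold discount
  fun_prop

theorem pastSigma_le (M : Market Ω) (n : ℕ) : M.pastSigma n ≤ mΩ :=
  measurable_iff_comap_le.1 (M.measurable_past n)

/-- The discount factor at `τ n` is a function of the past, and the next gap is independent of the
past with law `Exp(lam)`, whose Laplace transform at `ρ` is `lam / (lam + ρ)`. -/
theorem IsPoissonWith.lintegral_discount_succ [IsProbabilityMeasure P] {lam ρ : ℝ}
    {p : Measure ℝ} [IsProbabilityMeasure p] (hlam : 0 < lam) (hρ : 0 < ρ)
    (hM : M.IsPoissonWith P lam p) (n : ℕ) {f : Ω → ℝ≥0∞} (hf : Measurable[M.pastSigma n] f) :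
    ∫⁻ ω, M.discount ρ (n + 1) ω * f ω ∂P =
      ENNReal.ofReal (lam / (lam + ρ)) * ∫⁻ ω, M.discount ρ n ω * f ω ∂P := by
  have := isProbabilityMeasure_expMeasure hlam
  have := Measure.isProbabilityMeasure_map (μ := P) (M.measurable_past n).aemeasurable
  obtain ⟨h, hh, rfl⟩ := hf.exists_eq_measurable_comp
  let d : (ℕ → ℝ × ℝ) → ℝ≥0∞ :=
    fun s => ENNReal.ofReal (Real.exp (-ρ * ∑ i ∈ Finset.range n, (s i).1)) * h s
  have hd : Measurable d := by
    refine Measurable.mul ?_ hh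
    have : Measurable fun s : ℕ → ℝ × ℝ => ∑ i ∈ Finset.range n, (s i).1 :=
      Finset.measurable_sum _ fun i _ => (measurable_pi_apply i).fst
    fun_prop
  have he : Measurable fun t : ℝ => ENNReal.ofReal (Real.exp (-ρ * t)) := by fun_prop
  have h1 : ∀ ω, M.discount ρ n ω * (h ∘ M.past n) ω = d (M.past n ω) := fun ω => by
    simp only [d, discount, M.τ_eq_sum_past le_rfl, Function.comp]
  have h2 : ∀ ω, M.discount ρ (n + 1) ω * (h ∘ M.past n) ω =
      (fun s : (ℕ → ℝ × ℝ) × ℝ => d s.1 * ENNReal.ofReal (Real.exp (-ρ * s.2)))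
        (M.pastGap n ω) := fun ω => by
    simp only [d, discount, M.τ_succ_eq_pastGap, Function.comp]
    rw [mul_add, Real.exp_add, ENNReal.ofReal_mul (Real.exp_pos _).le]
    simp only [pastGap]
    ring
  simp_rw [h1, h2]
  rw [← lintegral_map (f := fun s : (ℕ → ℝ × ℝ) × ℝ =>
      d s.1 * ENNReal.ofReal (Real.exp (-ρ * s.2)))
      ((hd.comp measurable_fst).mul (he.comp measurable_snd)) (M.measurable_pastGap n),
    hM.map_pastGap hlam, lintegral_prod_mul hd.aemeasurable he.aemeasurable,
    lintegral_exp_expMeasure hlam hρ, lintegral_map hd (M.measurable_past n), mul_comm]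

theorem IsPoissonWith.lintegral_discount [IsProbabilityMeasure P] {lam ρ : ℝ}
    {p : Measure ℝ} [IsProbabilityMeasure p] (hlam : 0 < lam) (hρ : 0 < ρ)
    (hM : M.IsPoissonWith P lam p) (n : ℕ) :
    ∫⁻ ω, M.discount ρ n ω ∂P = ENNReal.ofReal (lam / (lam + ρ)) ^ n := by
  induction n with
  | zero => simp [discount, M.τ_zero]
  | succ n ih =>
    have := hM.lintegral_discount_succ hlam hρ n (f := fun _ => 1) measurable_const
    simp only [mul_one] at this
    rw [this, ih, pow_succ']

/-- The expectations of `e^{-τ_n}` form a convergent geometric series, so `e^{-τ_n} → 0` almost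
surely. It ensures that the trading periods cover the whole half-line. -/
theorem IsPoissonWith.exists_lt_τ [IsProbabilityMeasure P] {lam : ℝ}
    {p : Measure ℝ} [IsProbabilityMeasure p] (hlam : 0 < lam)
    (hM : M.IsPoissonWith P lam p) : ∀ᵐ ω ∂P, ∀ t : ℝ, ∃ n, t < M.τ n ω := by
  have h1 : ∫⁻ ω, ∑' n, M.discount 1 n ω ∂P ≠ ⊤ := by
    rw [lintegral_tsum fun n => (M.measurable_discount 1 n).aemeasurable]
    simp_rw [hM.lintegral_discount hlam one_pos]
    rw [ENNReal.tsum_geometric, ENNReal.inv_ne_top]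
    have : ENNReal.ofReal (lam / (lam + 1)) < 1 := by
      rw [ENNReal.ofReal_lt_one, div_lt_one (by positivity)]
      linarith
    exact (tsub_pos_of_lt this).ne'
  filter_upwards [ae_lt_top (Measurable.tsum fun n => M.measurable_discount 1 n) h1]
    with ω hω t
  have h2 := ENNReal.tendsto_atTop_zero_of_tsum_ne_top hω.ne
  obtain ⟨n, hn⟩ := (h2.eventually_lt_const
    (ENNReal.ofReal_pos.2 (Real.exp_pos (-1 * t)))).exists
  refine ⟨n, ?_⟩
  rw [discount, ENNReal.ofReal_lt_ofReal_iff (Real.exp_pos _), Real.exp_lt_exp] at hn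
  linarith

/-- Admissibility concerns the realised return only. Both `preWealth` and the investment are
functions of `pastGap`, of which the return is independent; by Fubini the constraint holds for
`p`-almost every `z`, hence on the support. -/
theorem Admissible.ae_solvent_support [IsProbabilityMeasure P] {lam : ℝ}
    {p : Measure ℝ} [IsProbabilityMeasure p] (hlam : 0 < lam)
    (hM : M.IsPoissonWith P lam p) (h : M.Admissible P x α c) (n : ℕ) :
    ∀ᵐ ω ∂P, ∀ z ∈ p.support, 0 ≤ M.preWealth x α c n ω + α (n + 1) ω * z := by
  obtain ⟨y, hy, hy'⟩ := (h.measurable_preWealth n).exists_eq_measurable_comp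
  obtain ⟨a, ha, ha'⟩ := (h.measurable_invest n).exists_eq_measurable_comp
  have hms : MeasurableSet {q : ((ℕ → ℝ × ℝ) × ℝ) × ℝ | 0 ≤ y q.1 + a q.1 * q.2} := by
    apply measurableSet_le measurable_const
    fun_prop
  have h1 : ∀ᵐ q ∂((P.map (M.pastGap n)).prod p), 0 ≤ y q.1 + a q.1 * q.2 := by
    rw [← hM.map_pastGap_Z' hlam, ae_map_iff
      ((M.measurable_pastGap n).prodMk (M.measurable_step n).snd).aemeasurable hms]
    filter_upwards [h.solvent] with ω hω
    have := hω (n + 1) (by omega)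
    rw [wealth_succ, hy', ha'] at this
    exact this
  have h2 := ae_of_ae_map (M.measurable_pastGap n).aemeasurable (Measure.ae_ae_of_ae_prod h1)
  rw [hy', ha']
  exact h2.mono fun ω hω => nonneg_on_support hω

theorem Admissible.preWealth_le (h : M.Admissible P x α c) :
    ∀ᵐ ω ∂P, ∀ n, M.preWealth x α c n ω ≤ M.wealth x α c n ω := by
  filter_upwards [h.integrable] with ω hω n
  rw [M.preWealth_eq hω, sub_le_self_iff]
  exact intervalIntegral.integral_nonneg (by exact_mod_cast (M.τ_lt n ω).le)
    fun t ht => h.nonneg t ω ((NNReal.coe_nonneg _).trans ht.1)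

theorem Admissible.wealth_nonneg (hx : 0 ≤ x) (h : M.Admissible P x α c) :
    ∀ᵐ ω ∂P, ∀ n, 0 ≤ M.wealth x α c n ω := by
  filter_upwards [h.solvent] with ω hω n
  rcases n with _ | n
  · rwa [wealth_zero]
  · exact hω _ (by omega)

/-- Contraction of the discounted expected `γ`-th power of the wealth between trading dates. -/
theorem Admissible.lintegral_wealth_succ [IsProbabilityMeasure P] {lam ρ γ zlow k b : ℝ}
    {zbar : EReal} {p : Measure ℝ} (hlam : 0 < lam) (hρ : 0 < ρ) (hγ0 : 0 < γ) (hγ1 : γ < 1)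
    (hp : IsReturnLaw p zlow zbar k b) (hM : M.IsPoissonWith P lam p) (hx : 0 ≤ x)
    (h : M.Admissible P x α c) (n : ℕ) :
    ∫⁻ ω, M.discount ρ (n + 1) ω * ENNReal.ofReal (M.wealth x α c (n + 1) ω ^ γ) ∂P ≤
      ENNReal.ofReal (lam / (lam + ρ) * (k / zlow) ^ γ) *
        ∫⁻ ω, M.discount ρ n ω * ENNReal.ofReal (M.wealth x α c n ω ^ γ) ∂P := by
  have := hp.isProbabilityMeasure
  have hk : 0 ≤ k / zlow := div_nonneg hp.k_nonneg hp.zlow_pos.le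
  obtain ⟨y, hy, hy'⟩ := (h.measurable_preWealth n).exists_eq_measurable_comp
  obtain ⟨a, ha, ha'⟩ := (h.measurable_invest n).exists_eq_measurable_comp
  let d : (ℕ → ℝ × ℝ) × ℝ → ℝ≥0∞ := fun s =>
    ENNReal.ofReal (Real.exp (-ρ * (∑ i ∈ Finset.range n, (s.1 i).1 + s.2)))
  have hd : Measurable d := by
    have : Measurable fun s : (ℕ → ℝ × ℝ) × ℝ => ∑ i ∈ Finset.range n, (s.1 i).1 :=
      Finset.measurable_sum _ fun i _ => ((measurable_pi_apply i).comp measurable_fst).fst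
    fun_prop
  have hdω : ∀ ω, M.discount ρ (n + 1) ω = d (M.pastGap n ω) := fun ω => by
    simp only [discount, d, M.τ_succ_eq_pastGap]
  have hF : Measurable fun q : ((ℕ → ℝ × ℝ) × ℝ) × ℝ =>
      ENNReal.ofReal ((y q.1 + a q.1 * q.2) ^ γ) := by fun_prop
  -- The next return is integrated out given the past and the gap; Jensen's bound then leaves a
  -- function of the past, against which the gap is integrated out.
  have h1 : ∫⁻ ω, M.discount ρ (n + 1) ω * ENNReal.ofReal (M.wealth x α c (n + 1) ω ^ γ) ∂P =
      ∫⁻ ω, d (M.pastGap n ω) *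
        ∫⁻ z, ENNReal.ofReal ((M.preWealth x α c n ω + α (n + 1) ω * z) ^ γ) ∂p ∂P := by
    simp_rw [hdω, wealth_succ, hy', ha', Function.comp]
    rw [← lintegral_map (f := fun q : ((ℕ → ℝ × ℝ) × ℝ) × ℝ =>
        d q.1 * ENNReal.ofReal ((y q.1 + a q.1 * q.2) ^ γ))
        ((hd.comp measurable_fst).mul hF)
        ((M.measurable_pastGap n).prodMk (M.measurable_step n).snd),
      hM.map_pastGap_Z' hlam, lintegral_prod
        (fun q : ((ℕ → ℝ × ℝ) × ℝ) × ℝ => d q.1 * ENNReal.ofReal ((y q.1 + a q.1 * q.2) ^ γ))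
        ((hd.comp measurable_fst).mul hF).aemeasurable]
    rw [← lintegral_map (f := fun s : (ℕ → ℝ × ℝ) × ℝ =>
        d s * ∫⁻ z, ENNReal.ofReal ((y s + a s * z) ^ γ) ∂p)
        (hd.mul hF.lintegral_prod_right') (M.measurable_pastGap n)]
    refine lintegral_congr fun s => ?_
    exact lintegral_const_mul' (d s) _ ENNReal.ofReal_ne_top
  have hw : Measurable[M.pastSigma n] fun ω => ENNReal.ofReal (M.wealth x α c n ω ^ γ) :=
    ((h.measurable_wealth n).pow_const γ).ennreal_ofReal
  calc _ = _ := h1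
    _ ≤ ∫⁻ ω, M.discount ρ (n + 1) ω *
        (ENNReal.ofReal ((k / zlow) ^ γ) * ENNReal.ofReal (M.wealth x α c n ω ^ γ)) ∂P := by
      refine lintegral_mono_ae ?_
      filter_upwards [h.ae_solvent_support hlam hM n, h.preWealth_le, h.wealth_nonneg hx]
        with ω h2 h3 h4
      rw [← hdω, ← ENNReal.ofReal_mul (by positivity), ← Real.mul_rpow hk (h4 n)]
      gcongr
      exact hp.lintegral_rpow_le hγ0 hγ1 h2 (h3 n)
    _ = _ := by
      rw [hM.lintegral_discount_succ hlam hρ n (f := fun ω => ENNReal.ofReal ((k / zlow) ^ γ) *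
          ENNReal.ofReal (M.wealth x α c n ω ^ γ)) (measurable_const.mul hw),
        ENNReal.ofReal_mul (by positivity), mul_assoc]
      congr 1
      rw [← lintegral_const_mul' _ _ ENNReal.ofReal_ne_top]
      refine lintegral_congr fun ω => ?_
      ring

theorem Admissible.lintegral_wealth_le [IsProbabilityMeasure P] {lam ρ γ zlow k b : ℝ}
    {zbar : EReal} {p : Measure ℝ} (hlam : 0 < lam) (hρ : 0 < ρ) (hγ0 : 0 < γ) (hγ1 : γ < 1)
    (hp : IsReturnLaw p zlow zbar k b) (hM : M.IsPoissonWith P lam p) (hx : 0 ≤ x)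
    (h : M.Admissible P x α c) (n : ℕ) :
    ∫⁻ ω, M.discount ρ n ω * ENNReal.ofReal (M.wealth x α c n ω ^ γ) ∂P ≤
      ENNReal.ofReal (lam / (lam + ρ) * (k / zlow) ^ γ) ^ n * ENNReal.ofReal (x ^ γ) := by
  induction n with
  | zero => simp [discount, M.τ_zero, wealth_zero]
  | succ n ih =>
    refine (h.lintegral_wealth_succ hlam hρ hγ0 hγ1 hp hM hx n).trans ?_
    rw [pow_succ', mul_assoc]
    gcongr

theorem Admissible.measurable_consumption (h : M.Admissible P x α c) (ω : Ω) :
    AEMeasurable (fun t => c t ω) (volume.restrict (Ioi 0)) := by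
  have h1 : Measurable fun t : ℝ≥0 => c t ω := by
    have h2 : Measurable[M.obs.predictable, inferInstance]
        (Function.uncurry fun (t : ℝ≥0) (ω : Ω) => c (t : ℝ) ω) :=
      StronglyMeasurable.measurable h.predictable
    have hle : M.obs.predictable ≤ (inferInstance : MeasurableSpace (ℝ≥0 × Ω)) := by
      refine MeasurableSpace.generateFrom_le ?_
      rintro _ (⟨A, hA, rfl⟩ | ⟨t, A, hA, rfl⟩)
      · exact (measurableSet_singleton _).prod (M.obs.le _ _ hA)
      · exact measurableSet_Ioi.prod (M.obs.le _ _ hA)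
    exact (h2.mono hle le_rfl).comp measurable_prodMk_right
  refine (h1.comp measurable_real_toNNReal).aemeasurable.congr ?_
  filter_upwards [ae_restrict_mem measurableSet_Ioi] with t ht
  simp [Real.coe_toNNReal _ (le_of_lt ht)]

/-- The utility of each trading period is bounded by the discounted `γ`-th power of the wealth at
its start; the expectations of these are summed by the contraction. -/
theorem Admissible.lintegral_utility_le [IsProbabilityMeasure P] {lam ρ γ K₁ zlow k b : ℝ}
    {zbar : EReal} {p : Measure ℝ} {U : ℝ → ℝ} (hlam : 0 < lam) (hρ : 0 < ρ)
    (hU : IsUtility U γ K₁) (hp : IsReturnLaw p zlow zbar k b) (hM : M.IsPoissonWith P lam p)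
    (hx : 0 ≤ x) (h : M.Admissible P x α c) :
    ∫⁻ ω, (∫⁻ t in Ioi (0 : ℝ), ENNReal.ofReal (Real.exp (-ρ * t) * U (c t ω))) ∂P ≤
      ENNReal.ofReal (K₁ * (1 + 1 / ρ)) *
        ((1 - ENNReal.ofReal (lam / (lam + ρ) * (k / zlow) ^ γ))⁻¹ * ENNReal.ofReal (x ^ γ)) := by
  have := hp.isProbabilityMeasure
  have hpath : ∀ᵐ ω ∂P, ∫⁻ t in Ioi (0 : ℝ), ENNReal.ofReal (Real.exp (-ρ * t) * U (c t ω)) ≤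
      ∑' n, ENNReal.ofReal (K₁ * (1 + 1 / ρ)) *
        (M.discount ρ n ω * ENNReal.ofReal (M.wealth x α c n ω ^ γ)) := by
    have hsupp := ae_all_iff.2 fun n => h.ae_solvent_support hlam hM n
    filter_upwards [hM.exists_lt_τ hlam, hsupp, h.preWealth_le, h.wealth_nonneg hx, h.integrable]
      with ω h1 h2 h3 h4 h5
    have hcover : Ioi (0 : ℝ) ⊆ ⋃ n, Ioc (M.τ n ω : ℝ) (M.τ (n + 1) ω) := by
      intro t ht
      classical
      have hex : ∃ n, t ≤ M.τ n ω := (h1 t).imp fun n hn => hn.le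
      have hne : Nat.find hex ≠ 0 := by
        intro h0
        have := Nat.find_spec hex
        rw [h0, M.τ_zero] at this
        exact absurd (lt_of_lt_of_le (mem_Ioi.1 ht) this) (lt_irrefl _)
      obtain ⟨n, hn⟩ := Nat.exists_eq_succ_of_ne_zero hne
      refine mem_iUnion.2 ⟨n, ?_, ?_⟩
      · exact not_le.1 (Nat.find_min hex (m := n) (by omega))
      · have := Nat.find_spec hex
        rwa [hn] at this
    refine (lintegral_mono_set hcover).trans ((lintegral_iUnion_le _ _).trans ?_)
    refine ENNReal.tsum_le_tsum fun n => ?_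
    have hτ0 : (0 : ℝ) ≤ M.τ n ω := NNReal.coe_nonneg _
    have hsub : Ioc (M.τ n ω : ℝ) (M.τ (n + 1) ω) ⊆ Ioi 0 := fun t ht => hτ0.trans_lt ht.1
    have hτ : (M.τ n ω : ℝ) ≤ M.τ (n + 1) ω := by exact_mod_cast (M.τ_lt n ω).le
    refine hU.lintegral_le hρ (h4 n) measurableSet_Ioc (fun t ht => ht.1)
      ((h.measurable_consumption ω).mono_measure (Measure.restrict_mono hsub le_rfl))
      (fun t ht => h.nonneg t ω (hτ0.trans ht.1.le)) ?_
    have hi : IntervalIntegrable (fun t => c t ω) volume (M.τ n ω) (M.τ (n + 1) ω) :=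
      (h5 n).symm.trans (h5 (n + 1))
    rw [← ofReal_integral_eq_lintegral_ofReal ((intervalIntegrable_iff_integrableOn_Ioc_of_le hτ).1 hi)
      ((ae_restrict_mem measurableSet_Ioc).mono fun t ht => h.nonneg t ω (hτ0.trans ht.1.le)),
      ← intervalIntegral.integral_of_le hτ]
    apply ENNReal.ofReal_le_ofReal
    -- Nonnegativity of `preWealth` says that the consumption between two dates does not exceed the
    -- wealth at the first.
    have h6 := (hp.solvent_bounds (h2 n) (h3 n)).1
    rw [M.preWealth_eq h5] at h6
    linarith
  have hmeas : ∀ n, Measurable fun ω =>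
      M.discount ρ n ω * ENNReal.ofReal (M.wealth x α c n ω ^ γ) := fun n =>
    (M.measurable_discount ρ n).mul
      ((((h.measurable_wealth n).mono (M.pastSigma_le n) le_rfl).pow_const γ).ennreal_ofReal)
  calc _ ≤ _ := lintegral_mono_ae hpath
    _ = ∑' n, ENNReal.ofReal (K₁ * (1 + 1 / ρ)) *
        ∫⁻ ω, M.discount ρ n ω * ENNReal.ofReal (M.wealth x α c n ω ^ γ) ∂P := by
      rw [lintegral_tsum fun n => ((hmeas n).const_mul _).aemeasurable]
      simp_rw [lintegral_const_mul' _ _ ENNReal.ofReal_ne_top]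
    _ ≤ _ := by
      rw [ENNReal.tsum_mul_left, ← ENNReal.tsum_geometric, ← ENNReal.tsum_mul_right]
      gcongr with n
      exact h.lintegral_wealth_le hlam hρ hU.gamma_pos hU.gamma_lt_one hp hM hx n

theorem exists_value_le [IsProbabilityMeasure P] {lam ρ γ K₁ zlow k b : ℝ}
    {zbar : EReal} {p : Measure ℝ} {U : ℝ → ℝ} (hlam : 0 < lam) (hρ : 0 < ρ)
    (hU : IsUtility U γ K₁) (hp : IsReturnLaw p zlow zbar k b) (hM : M.IsPoissonWith P lam p)
    (hdisc : b * γ + lam * (k ^ γ / zlow ^ γ - 1) < ρ) :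
    ∃ C : ℝ≥0∞, C ≠ ⊤ ∧ ∀ x, 0 ≤ x → M.value P U ρ x ≤ C * ENNReal.ofReal (x ^ γ) := by
  refine ⟨ENNReal.ofReal (K₁ * (1 + 1 / ρ)) *
    (1 - ENNReal.ofReal (lam / (lam + ρ) * (k / zlow) ^ γ))⁻¹, ?_, fun x hx => ?_⟩
  -- Since `b * γ ≥ 0`, the discount condition gives `lam * (k / zlow) ^ γ < lam + ρ`.
  · have hq : ENNReal.ofReal (lam / (lam + ρ) * (k / zlow) ^ γ) < 1 := by
      rw [ENNReal.ofReal_lt_one, Real.div_rpow hp.k_nonneg hp.zlow_pos.le, div_mul_eq_mul_div,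
        div_lt_one (by positivity)]
      have := mul_nonneg hp.b_nonneg hU.gamma_pos.le
      nlinarith
    exact ENNReal.mul_ne_top ENNReal.ofReal_ne_top (ENNReal.inv_ne_top.2 (tsub_pos_of_lt hq).ne')
  · rw [mul_assoc]
    exact iSup_le fun α => iSup_le fun c => iSup_le fun h =>
      h.lintegral_utility_le hlam hρ hU hp hM hx

end Market

/-! ### Monotonicity and concavity of the value function and of the gain. -/

theorem IsUtility.add_ofReal_le {U : ℝ → ℝ} {γ K₁ : ℝ} (hU : IsUtility U γ K₁) {x y s t : ℝ}
    (hx : 0 ≤ x) (hy : 0 ≤ y) (hs : 0 ≤ s) (ht : 0 ≤ t) (hst : s + t = 1) :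
    ENNReal.ofReal s * ENNReal.ofReal (U x) + ENNReal.ofReal t * ENNReal.ofReal (U y) ≤
      ENNReal.ofReal (U (s * x + t * y)) := by
  have h1 := hU.nonneg hx
  have h2 := hU.nonneg hy
  rw [← ENNReal.ofReal_mul hs, ← ENNReal.ofReal_mul ht,
    ← ENNReal.ofReal_add (by positivity) (by positivity)]
  exact ENNReal.ofReal_le_ofReal (hU.strictConcave.concaveOn.2 hx hy hs ht hst)

/-- The lower integral is superadditive without any measurability, so concavity passes through
integrals of arbitrary integrands. -/
theorem lintegral_add_le_of_le {X : Type*} [MeasurableSpace X] {μ : Measure X}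
    {f g h : X → ℝ≥0∞} {s t : ℝ} (H : ∀ᵐ a ∂μ,
      ENNReal.ofReal s * f a + ENNReal.ofReal t * g a ≤ h a) :
    ENNReal.ofReal s * ∫⁻ a, f a ∂μ + ENNReal.ofReal t * ∫⁻ a, g a ∂μ ≤ ∫⁻ a, h a ∂μ := by
  rw [← lintegral_const_mul' _ _ ENNReal.ofReal_ne_top,
    ← lintegral_const_mul' _ _ ENNReal.ofReal_ne_top]
  exact (le_lintegral_add _ _).trans (lintegral_mono_ae H)

namespace Market

variable {Ω : Type*} [mΩ : MeasurableSpace Ω] {M : Market Ω} {P : Measure Ω}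
  {x : ℝ} {α : ℕ → Ω → ℝ} {c : ℝ → Ω → ℝ}

theorem Admissible.mono {y : ℝ} (hxy : x ≤ y) (h : M.Admissible P x α c) :
    M.Admissible P y α c where
  invest := h.invest
  predictable := h.predictable
  nonneg := h.nonneg
  integrable := h.integrable
  solvent := by
    filter_upwards [h.solvent] with ω hω n hn
    have := hω n hn
    simp only [wealth] at this ⊢
    linarith

theorem admissible_zero (hx : 0 ≤ x) : M.Admissible P x (fun _ _ => 0) (fun _ _ => 0) where
  invest _ := measurable_const
  predictable := stronglyMeasurable_const
  nonneg _ _ _ := le_rfl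
  integrable := ae_of_all _ fun _ _ => by simp
  solvent := ae_of_all _ fun _ _ _ => by simpa [wealth] using hx

theorem Admissible.convex {y s t : ℝ} {α' : ℕ → Ω → ℝ} {c' : ℝ → Ω → ℝ}
    (hs : 0 ≤ s) (ht : 0 ≤ t) (h : M.Admissible P x α c)
    (h' : M.Admissible P y α' c') :
    M.Admissible P (s * x + t * y) (fun n ω => s * α n ω + t * α' n ω)
      (fun u ω => s * c u ω + t * c' u ω) where
  invest n := ((h.invest n).const_mul s).add ((h'.invest n).const_mul t)
  predictable :=
    (StronglyMeasurable.const_mul h.predictable s).add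
      (StronglyMeasurable.const_mul h'.predictable t)
  nonneg u ω hu := by
    have := h.nonneg u ω hu
    have := h'.nonneg u ω hu
    positivity
  integrable := by
    filter_upwards [h.integrable, h'.integrable] with ω h1 h2 n
    exact ((h1 n).const_mul s).add ((h2 n).const_mul t)
  solvent := by
    filter_upwards [h.integrable, h'.integrable, h.solvent, h'.solvent] with ω h1 h2 h3 h4 n hn
    have e : M.wealth (s * x + t * y) (fun n ω => s * α n ω + t * α' n ω)
        (fun u ω => s * c u ω + t * c' u ω) n ω =
        s * M.wealth x α c n ω + t * M.wealth y α' c' n ω := by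
      simp only [wealth]
      rw [intervalIntegral.integral_add ((h1 n).const_mul s) ((h2 n).const_mul t),
        intervalIntegral.integral_const_mul, intervalIntegral.integral_const_mul]
      simp only [add_mul, Finset.sum_add_distrib, mul_add, Finset.mul_sum, mul_assoc]
      ring
    rw [e]
    exact add_nonneg (mul_nonneg hs (h3 n hn)) (mul_nonneg ht (h4 n hn))

theorem value_mono {U : ℝ → ℝ} {ρ : ℝ} : Monotone (M.value P U ρ) := fun _ _ hxy =>
  iSup_mono fun _ => iSup_mono fun _ => iSup_mono' fun h => ⟨h.mono hxy, le_rfl⟩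

theorem value_concave {U : ℝ → ℝ} {γ K₁ ρ : ℝ} (hU : IsUtility U γ K₁) {y s t : ℝ} (hx : 0 ≤ x)
    (hy : 0 ≤ y) (hs : 0 ≤ s) (ht : 0 ≤ t) (hst : s + t = 1) :
    ENNReal.ofReal s * M.value P U ρ x + ENNReal.ofReal t * M.value P U ρ y ≤
      M.value P U ρ (s * x + t * y) := by
  have hval : ∀ x, M.value P U ρ x = ⨆ (q : (ℕ → Ω → ℝ) × (ℝ → Ω → ℝ))
      (_ : M.Admissible P x q.1 q.2), ∫⁻ ω, (∫⁻ t in Ioi (0 : ℝ),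
        ENNReal.ofReal (Real.exp (-ρ * t) * U (q.2 t ω))) ∂P := fun x => by
    rw [value, iSup_prod]
  rw [hval x, hval y]
  simp_rw [ENNReal.mul_iSup]
  refine ENNReal.biSup_add_biSup_le' ⟨(_, _), admissible_zero hx⟩ ⟨(_, _), admissible_zero hy⟩
    fun q hq q' hq' => ?_
  refine le_trans ?_ (le_iSup_of_le _ (le_iSup_of_le _ (le_iSup_of_le (hq.convex hs ht hq')
    le_rfl)))
  refine lintegral_add_le_of_le (ae_of_all _ fun ω => lintegral_add_le_of_le ?_)
  filter_upwards [ae_restrict_mem measurableSet_Ioi] with u hu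
  have h1 := hU.add_ofReal_le (hq.nonneg u ω (le_of_lt hu)) (hq'.nonneg u ω (le_of_lt hu)) hs ht hst
  simp_rw [ENNReal.ofReal_mul (Real.exp_pos _).le]
  calc _ = ENNReal.ofReal (Real.exp (-ρ * u)) * (ENNReal.ofReal s * ENNReal.ofReal (U (q.2 u ω)) +
        ENNReal.ofReal t * ENNReal.ofReal (U (q'.2 u ω))) := by ring
    _ ≤ _ := by gcongr

end Market

theorem IsReturnLaw.nonneg_of_lowerWealth_le {p : Measure ℝ} {zlow : ℝ} {zbar : EReal} {k b : ℝ}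
    (hp : IsReturnLaw p zlow zbar k b) {a y z : ℝ} (ha : a ∈ investSet zbar)
    (hy : lowerWealth zlow zbar a ≤ y) (hz : z ∈ p.support) : 0 ≤ y + a * z := by
  obtain ⟨h1, h2⟩ := hp.mem_support_bounds hz
  unfold lowerWealth at hy
  split_ifs at hy with htop
  · have := ha htop
    nlinarith
  · obtain ⟨h3, h4⟩ := max_le_iff.1 hy
    lift zbar to ℝ using ⟨htop, (hp.zbar_pos.trans' EReal.bot_lt_zero).ne'⟩
    have h5 : z ≤ zbar := by exact_mod_cast h2
    simp only [EReal.toReal_coe] at h4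
    rcases le_total 0 a with h | h <;> nlinarith

theorem gain_mono {lam : ℝ} {p : Measure ℝ} {v : ℝ → ℝ≥0∞} (hv : Monotone v) (a : ℝ) :
    Monotone fun y => gain lam p v y a := fun _ _ hxy =>
  mul_le_mul_right (lintegral_mono fun _ => hv (by linarith)) _

theorem IsReturnLaw.gain_lt_top {p : Measure ℝ} {zlow : ℝ} {zbar : EReal} {k b : ℝ}
    (hp : IsReturnLaw p zlow zbar k b) {lam γ : ℝ} (hγ0 : 0 < γ) (hγ1 : γ < 1) {v : ℝ → ℝ≥0∞}
    {C : ℝ≥0∞} (hC : C ≠ ⊤) (hv : ∀ x, 0 ≤ x → v x ≤ C * ENNReal.ofReal (x ^ γ)) {a y : ℝ}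
    (ha : a ∈ investSet zbar) (hy : lowerWealth zlow zbar a ≤ y) : gain lam p v y a < ⊤ := by
  have h0 : ∀ z ∈ p.support, 0 ≤ y + a * z := fun z hz => hp.nonneg_of_lowerWealth_le ha hy hz
  refine ENNReal.mul_lt_top ENNReal.ofReal_lt_top ?_
  calc ∫⁻ z, v (y + a * z) ∂p ≤ ∫⁻ z, C * ENNReal.ofReal ((y + a * z) ^ γ) ∂p :=
        lintegral_mono_ae ((ae_mem_support p).mono fun z hz => hv _ (h0 z hz))
    _ = C * ∫⁻ z, ENNReal.ofReal ((y + a * z) ^ γ) ∂p := lintegral_const_mul' _ _ hC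
    _ ≤ C * ENNReal.ofReal ((k / zlow * y) ^ γ) := by
        gcongr
        exact hp.lintegral_rpow_le hγ0 hγ1 h0 le_rfl
    _ < ⊤ := ENNReal.mul_lt_top hC.lt_top ENNReal.ofReal_lt_top

theorem IsReturnLaw.gain_concave {p : Measure ℝ} {zlow : ℝ} {zbar : EReal} {k b : ℝ}
    (hp : IsReturnLaw p zlow zbar k b) {lam : ℝ} {v : ℝ → ℝ≥0∞}
    (hv : ∀ x y s t : ℝ, 0 ≤ x → 0 ≤ y → 0 ≤ s → 0 ≤ t → s + t = 1 →
      ENNReal.ofReal s * v x + ENNReal.ofReal t * v y ≤ v (s * x + t * y)) {a x y s t : ℝ}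
    (ha : a ∈ investSet zbar) (hx : lowerWealth zlow zbar a ≤ x)
    (hy : lowerWealth zlow zbar a ≤ y) (hs : 0 ≤ s) (ht : 0 ≤ t) (hst : s + t = 1) :
    ENNReal.ofReal s * gain lam p v x a + ENNReal.ofReal t * gain lam p v y a ≤
      gain lam p v (s * x + t * y) a := by
  have h : ENNReal.ofReal s * ∫⁻ z, v (x + a * z) ∂p + ENNReal.ofReal t * ∫⁻ z, v (y + a * z) ∂p ≤
      ∫⁻ z, v (s * x + t * y + a * z) ∂p := by
    refine lintegral_add_le_of_le ((ae_mem_support p).mono fun z hz => ?_)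
    have := hv (x + a * z) (y + a * z) s t (hp.nonneg_of_lowerWealth_le ha hx hz)
      (hp.nonneg_of_lowerWealth_le ha hy hz) hs ht hst
    have e : s * (x + a * z) + t * (y + a * z) = s * x + t * y + a * z := by
      linear_combination a * z * hst
    rwa [e] at this
  unfold gain
  calc _ = ENNReal.ofReal lam * (ENNReal.ofReal s * ∫⁻ z, v (x + a * z) ∂p +
        ENNReal.ofReal t * ∫⁻ z, v (y + a * z) ∂p) := by ring
    _ ≤ _ := by gcongr

/-! ### The deterministic consumption problem. -/

/-- The payoff `∫_0^∞ e^{-β s} [U(c_s) + g(Y_s)] ds` of a consumption rate `c` from the initial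
wealth `x`, with `Y_s = x - ∫_0^s c`. -/
noncomputable def detPayoff (U : ℝ → ℝ) (β : ℝ) (g : ℝ → ℝ≥0∞) (x : ℝ) (c : ℝ → ℝ) : ℝ≥0∞ :=
  ∫⁻ s in Ioi (0 : ℝ), ENNReal.ofReal (Real.exp (-β * s)) *
    (ENNReal.ofReal (U (c s)) + g (x - ∫ u in (0 : ℝ)..s, c u))

/-- The value function of the deterministic consumption problem with running reward `g`. -/
noncomputable def detValue (U : ℝ → ℝ) (β : ℝ) (g : ℝ → ℝ≥0∞) (l x : ℝ) : ℝ≥0∞ :=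
  ⨆ (c : ℝ → ℝ) (_ : DetAdmissible l x c), detPayoff U β g x c

theorem auxValue_eq (U : ℝ → ℝ) (ρ lam zlow : ℝ) (zbar : EReal) (p : Measure ℝ)
    (v : ℝ → ℝ≥0∞) (x a : ℝ) :
    auxValue U ρ lam zlow zbar p v x a =
      detValue U (ρ + lam) (fun y => gain lam p v y a) (lowerWealth zlow zbar a) x := rfl

section Deterministic

variable {U : ℝ → ℝ} {β l x y γ K₁ : ℝ} {g : ℝ → ℝ≥0∞} {c : ℝ → ℝ}

theorem detAdmissible_zero (hx : l ≤ x) : DetAdmissible l x (fun _ => 0) where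
  measurable := measurable_const
  nonneg _ _ := le_rfl
  integrable _ _ := by simp
  budget _ _ := by simpa using hx

theorem DetAdmissible.mono (h : DetAdmissible l x c) (hxy : x ≤ y) : DetAdmissible l y c where
  measurable := h.measurable
  nonneg := h.nonneg
  integrable := h.integrable
  budget t ht := (h.budget t ht).trans (by linarith)

theorem DetAdmissible.convex {c' : ℝ → ℝ} {s t : ℝ} (hs : 0 ≤ s) (ht : 0 ≤ t) (hst : s + t = 1)
    (h : DetAdmissible l x c) (h' : DetAdmissible l y c') :
    DetAdmissible l (s * x + t * y) (fun u => s * c u + t * c' u) where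
  measurable := (h.measurable.const_mul s).add (h'.measurable.const_mul t)
  nonneg u hu := by
    have := h.nonneg u hu
    have := h'.nonneg u hu
    positivity
  integrable u hu := ((h.integrable u hu).const_mul s).add ((h'.integrable u hu).const_mul t)
  budget u hu := by
    rw [intervalIntegral.integral_add ((h.integrable u hu).const_mul s)
      ((h'.integrable u hu).const_mul t), intervalIntegral.integral_const_mul,
      intervalIntegral.integral_const_mul]
    have h1 := mul_le_mul_of_nonneg_left (h.budget u hu) hs
    have h2 := mul_le_mul_of_nonneg_left (h'.budget u hu) ht
    have : l = (s + t) * l := by rw [hst, one_mul]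
    linarith

theorem DetAdmissible.integral_nonneg (h : DetAdmissible l x c) {t : ℝ} (ht : 0 ≤ t) :
    0 ≤ ∫ u in (0 : ℝ)..t, c u :=
  intervalIntegral.integral_nonneg ht fun u hu => h.nonneg u hu.1

theorem DetAdmissible.le (h : DetAdmissible l x c) : l ≤ x := by
  simpa using h.budget 0 le_rfl

theorem DetAdmissible.shift (h : DetAdmissible l x c) {t : ℝ} (ht : 0 ≤ t) :
    DetAdmissible l (x - ∫ u in (0 : ℝ)..t, c u) (fun u => c (u + t)) where
  measurable := h.measurable.comp (measurable_id.add_const t)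
  nonneg u hu := h.nonneg _ (by positivity)
  integrable u hu := by
    have := ((h.integrable t ht).symm.trans (h.integrable (u + t) (by positivity))).comp_add_right t
    simpa using this
  budget u hu := by
    rw [intervalIntegral.integral_comp_add_right (fun u => c u), zero_add,
      ← intervalIntegral.integral_interval_sub_left (h.integrable (u + t) (by positivity))
        (h.integrable t ht)]
    linarith [h.budget (u + t) (by positivity)]

theorem detValue_mono (hg : Monotone g) : Monotone (detValue U β g l) := fun x y hxy =>
  iSup_mono fun c => iSup_mono' fun h => ⟨h.mono hxy, lintegral_mono fun s => by
    gcongr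
    exact hg (by linarith)⟩

theorem detValue_concave (hU : IsUtility U γ K₁)
    (hg : ∀ x y s t : ℝ, l ≤ x → l ≤ y → 0 ≤ s → 0 ≤ t → s + t = 1 →
      ENNReal.ofReal s * g x + ENNReal.ofReal t * g y ≤ g (s * x + t * y)) {s t : ℝ} (hx : l ≤ x)
    (hy : l ≤ y) (hs : 0 ≤ s) (ht : 0 ≤ t) (hst : s + t = 1) :
    ENNReal.ofReal s * detValue U β g l x + ENNReal.ofReal t * detValue U β g l y ≤
      detValue U β g l (s * x + t * y) := by
  rw [detValue, detValue]
  simp_rw [ENNReal.mul_iSup]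
  refine ENNReal.biSup_add_biSup_le' ⟨_, detAdmissible_zero hx⟩ ⟨_, detAdmissible_zero hy⟩
    fun c hc c' hc' => ?_
  refine le_trans ?_ (le_iSup_of_le _ (le_iSup_of_le (hc.convex hs ht hst hc') le_rfl))
  refine lintegral_add_le_of_le ?_
  filter_upwards [ae_restrict_mem measurableSet_Ioi] with u hu
  have hu0 : 0 ≤ u := le_of_lt hu
  have h1 := hU.add_ofReal_le (hc.nonneg u hu0) (hc'.nonneg u hu0) hs ht hst
  have h2 := hg (x - ∫ v in (0 : ℝ)..u, c v) (y - ∫ v in (0 : ℝ)..u, c' v) s t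
    (by linarith [hc.budget u hu0]) (by linarith [hc'.budget u hu0]) hs ht hst
  have e : s * x + t * y - ∫ v in (0 : ℝ)..u, (s * c v + t * c' v) =
      s * (x - ∫ v in (0 : ℝ)..u, c v) + t * (y - ∫ v in (0 : ℝ)..u, c' v) := by
    rw [intervalIntegral.integral_add ((hc.integrable u hu0).const_mul s)
      ((hc'.integrable u hu0).const_mul t), intervalIntegral.integral_const_mul,
      intervalIntegral.integral_const_mul]
    ring
  rw [e]
  calc _ = ENNReal.ofReal (Real.exp (-β * u)) *
        ((ENNReal.ofReal s * ENNReal.ofReal (U (c u)) + ENNReal.ofReal t * ENNReal.ofReal (U (c' u)))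
        + (ENNReal.ofReal s * g (x - ∫ v in (0 : ℝ)..u, c v) +
          ENNReal.ofReal t * g (y - ∫ v in (0 : ℝ)..u, c' v))) := by ring
    _ ≤ _ := by gcongr

/-- Total consumption is at most `x - l` and the wealth never exceeds `x`. Besides finiteness, this
serves near `l`, where the first term vanishes. -/
theorem detValue_le (hU : IsUtility U γ K₁) (hβ : 0 < β) (hg : Monotone g) (hx : l ≤ x) :
    detValue U β g l x ≤ ENNReal.ofReal (K₁ * (1 + 1 / β)) * ENNReal.ofReal ((x - l) ^ γ) +
      ENNReal.ofReal (1 / β) * g x := by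
  refine iSup_le fun c => iSup_le fun h => ?_
  -- The budget on each `[0, n]` passes to the half-line by monotone convergence.
  have hcx : ∫⁻ t in Ioi (0 : ℝ), ENNReal.ofReal (c t) ≤ ENNReal.ofReal (x - l) := by
    have hmono : Monotone fun n : ℕ => Ioc (0 : ℝ) n := fun m n hmn =>
      Ioc_subset_Ioc_right (by exact_mod_cast hmn)
    have hU : (⋃ n : ℕ, Ioc (0 : ℝ) n) = Ioi 0 := by
      ext r
      simp only [mem_iUnion, mem_Ioc, mem_Ioi]
      exact ⟨fun ⟨_, h, _⟩ => h, fun h => (exists_nat_ge r).imp fun n hn => ⟨h, hn⟩⟩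
    rw [← hU, setLIntegral_iUnion_of_directed _ hmono.directed_le]
    refine iSup_le fun n => ?_
    have hn : (0 : ℝ) ≤ n := n.cast_nonneg
    rw [← ofReal_integral_eq_lintegral_ofReal
      ((intervalIntegrable_iff_integrableOn_Ioc_of_le hn).1 (h.integrable n hn))
      ((ae_restrict_mem measurableSet_Ioc).mono fun t ht => h.nonneg t ht.1.le),
      ← intervalIntegral.integral_of_le hn]
    exact ENNReal.ofReal_le_ofReal (h.budget n hn)
  have h1 := hU.lintegral_le hβ (sub_nonneg.2 hx) measurableSet_Ioi (subset_refl (Ioi (0 : ℝ)))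
    h.measurable.aemeasurable (fun t ht => h.nonneg t (le_of_lt ht)) hcx
  simp only [mul_zero, Real.exp_zero, ENNReal.ofReal_one, one_mul] at h1
  calc detPayoff U β g x c
      ≤ ∫⁻ s in Ioi (0 : ℝ), (ENNReal.ofReal (Real.exp (-β * s) * U (c s)) +
          ENNReal.ofReal (Real.exp (-β * s)) * g x) := by
        refine setLIntegral_mono' measurableSet_Ioi fun s hs => ?_
        rw [ENNReal.ofReal_mul (Real.exp_pos _).le, mul_add]
        gcongr
        exact hg (by linarith [h.integral_nonneg (le_of_lt hs)])
    _ = (∫⁻ s in Ioi (0 : ℝ), ENNReal.ofReal (Real.exp (-β * s) * U (c s))) +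
          ENNReal.ofReal (1 / β) * g x := by
        rw [lintegral_add_right _ (by fun_prop), lintegral_mul_const _ (by fun_prop),
          lintegral_exp_Ioi hβ]
        simp
    _ ≤ _ := by gcongr

/-! ### Dynamic programming over a short period. -/

theorem lintegral_exp_Ioc (hβ : 0 < β) {h : ℝ} (hh : 0 ≤ h) :
    ∫⁻ t in Ioc 0 h, ENNReal.ofReal (Real.exp (-β * t)) =
      ENNReal.ofReal ((1 - Real.exp (-β * h)) / β) := by
  have hc : IntervalIntegrable (fun t => Real.exp (-β * t)) volume 0 h :=
    (by fun_prop : Continuous fun t => Real.exp (-β * t)).intervalIntegrable _ _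
  rw [← ofReal_integral_eq_lintegral_ofReal
    ((intervalIntegrable_iff_integrableOn_Ioc_of_le hh).1 hc)
    (ae_of_all _ fun t => (Real.exp_pos _).le), ← intervalIntegral.integral_of_le hh,
    intervalIntegral.integral_comp_mul_left (fun x => Real.exp x) (neg_ne_zero.2 hβ.ne'),
    integral_exp]
  congr 1
  simp only [mul_zero, Real.exp_zero, smul_eq_mul]
  field_simp
  ring

theorem lintegral_Ioi_shift (f : ℝ → ℝ≥0∞) (h : ℝ) :
    ∫⁻ s in Ioi h, f s = ∫⁻ s in Ioi (0 : ℝ), f (s + h) := by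
  have := (measurePreserving_add_right (volume : Measure ℝ) h).setLIntegral_comp_preimage_emb
    (MeasurableEquiv.addRight h).measurableEmbedding f (Ioi h)
  rw [← this]
  simp

/-- The dynamic programming decomposition at the time `h`. -/
theorem detPayoff_eq_add (hc : ∀ t, 0 ≤ t → IntervalIntegrable c volume 0 t) {h : ℝ} (hh : 0 ≤ h) :
    detPayoff U β g x c =
      (∫⁻ s in Ioc 0 h, ENNReal.ofReal (Real.exp (-β * s)) *
        (ENNReal.ofReal (U (c s)) + g (x - ∫ u in (0 : ℝ)..s, c u))) +
      ENNReal.ofReal (Real.exp (-β * h)) *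
        detPayoff U β g (x - ∫ u in (0 : ℝ)..h, c u) (fun s => c (s + h)) := by
  rw [detPayoff, ← Ioc_union_Ioi_eq_Ioi hh,
    lintegral_union measurableSet_Ioi (Ioc_disjoint_Ioi le_rfl), lintegral_Ioi_shift, detPayoff,
    ← lintegral_const_mul' _ _ ENNReal.ofReal_ne_top]
  congr 1
  refine setLIntegral_congr_fun measurableSet_Ioi fun s hs => ?_
  have hs0 : 0 ≤ s := le_of_lt hs
  have e : x - ∫ u in (0 : ℝ)..(s + h), c u =
      x - (∫ u in (0 : ℝ)..h, c u) - ∫ u in (0 : ℝ)..s, c (u + h) := by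
    rw [intervalIntegral.integral_comp_add_right (fun u => c u), zero_add,
      ← intervalIntegral.integral_interval_sub_left (hc (s + h) (by positivity)) (hc h hh)]
    ring
  rw [e, ← mul_assoc, ← ENNReal.ofReal_mul (Real.exp_pos _).le, ← Real.exp_add]
  congr 4
  ring

/-- Consuming at the constant rate `c₀` up to time `h`, then following `c`. -/
noncomputable def delayed (c₀ h : ℝ) (c : ℝ → ℝ) (s : ℝ) : ℝ := if s ≤ h then c₀ else c (s - h)

theorem integral_delayed_of_le {c₀ h t : ℝ} (ht : t ≤ h) (ht0 : 0 ≤ t) :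
    IntervalIntegrable (delayed c₀ h c) volume 0 t ∧
      ∫ u in (0 : ℝ)..t, delayed c₀ h c u = c₀ * t := by
  have hEq : EqOn (fun _ : ℝ => c₀) (delayed c₀ h c) (uIcc 0 t) := fun u hu => by
    rw [uIcc_of_le ht0] at hu
    simp [delayed, hu.2.trans ht]
  refine ⟨(intervalIntegrable_const (c := c₀)).congr fun u hu => hEq (uIoc_subset_uIcc hu), ?_⟩
  rw [← intervalIntegral.integral_congr hEq]
  simp [mul_comm]

theorem integral_delayed_of_ge {c₀ h t : ℝ} (hh : 0 ≤ h) (ht : h ≤ t)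
    (hc : IntervalIntegrable c volume 0 (t - h)) :
    IntervalIntegrable (delayed c₀ h c) volume 0 t ∧
      ∫ u in (0 : ℝ)..t, delayed c₀ h c u = c₀ * h + ∫ u in (0 : ℝ)..(t - h), c u := by
  obtain ⟨h1, h2⟩ := integral_delayed_of_le (c := c) (c₀ := c₀) le_rfl hh
  have hEq : EqOn (fun u => c (u - h)) (delayed c₀ h c) (uIoc h t) := fun u hu => by
    rw [uIoc_of_le ht] at hu
    simp [delayed, not_le.2 hu.1]
  have h3 : IntervalIntegrable (fun u => c (u - h)) volume h t := by
    have := hc.comp_sub_right h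
    simpa using this
  have h4 := h3.congr hEq
  refine ⟨h1.trans h4, ?_⟩
  rw [← intervalIntegral.integral_add_adjacent_intervals h1 h4, h2,
    ← intervalIntegral.integral_congr_ae (ae_of_all _ hEq),
    intervalIntegral.integral_comp_sub_right (fun u => c u), sub_self]

theorem DetAdmissible.delayed {c₀ h : ℝ} (hc₀ : 0 ≤ c₀) (hh : 0 ≤ h)
    (hc : DetAdmissible l (x - c₀ * h) c) : DetAdmissible l x (delayed c₀ h c) where
  measurable := Measurable.ite measurableSet_Iic measurable_const
    (hc.measurable.comp (measurable_id.sub_const h))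
  nonneg t ht := by
    unfold Illiquid.delayed
    split_ifs with h1
    · exact hc₀
    · exact hc.nonneg _ (by linarith)
  integrable t ht := by
    rcases le_total t h with h1 | h1
    · exact (integral_delayed_of_le h1 ht).1
    · exact (integral_delayed_of_ge hh h1 (hc.integrable _ (by linarith))).1
  budget t ht := by
    rcases le_total t h with h1 | h1
    · rw [(integral_delayed_of_le h1 ht).2]
      nlinarith [hc.le]
    · rw [(integral_delayed_of_ge hh h1 (hc.integrable _ (by linarith))).2]
      linarith [hc.budget (t - h) (by linarith)]

/-- Lower half of dynamic programming: a constant rate up to `h` followed by any admissible rate is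
itself admissible. The wealth stays above `y` until `h`, so `g y` bounds the running reward from
below. -/
theorem detValue_ge_of_const (hβ : 0 < β) (hg : Monotone g) {c₀ h : ℝ} (hc₀ : 0 ≤ c₀) (hh : 0 ≤ h)
    (hy : y ≤ x - c₀ * h) (hl : l ≤ x - c₀ * h) :
    ENNReal.ofReal ((1 - Real.exp (-β * h)) / β) * (ENNReal.ofReal (U c₀) + g y) +
      ENNReal.ofReal (Real.exp (-β * h)) * detValue U β g l (x - c₀ * h) ≤ detValue U β g l x := by
  conv_lhs => rw [detValue]
  simp_rw [ENNReal.mul_iSup]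
  rw [ENNReal.add_biSup' (p := DetAdmissible l (x - c₀ * h)) ⟨_, detAdmissible_zero hl⟩]
  refine iSup_le fun c => iSup_le fun hc => ?_
  have hd := hc.delayed hc₀ hh
  refine le_trans ?_ (le_iSup_of_le _ (le_iSup_of_le hd le_rfl))
  rw [detPayoff_eq_add hd.integrable hh, (integral_delayed_of_le le_rfl hh).2]
  refine add_le_add ?_ ?_
  · rw [← lintegral_exp_Ioc hβ hh, ← lintegral_mul_const _ (by fun_prop)]
    refine setLIntegral_mono' measurableSet_Ioc fun s hs => ?_
    have h1 : delayed c₀ h c s = c₀ := if_pos hs.2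
    rw [h1, (integral_delayed_of_le hs.2 hs.1.le).2]
    gcongr
    exact hg (by nlinarith [hs.2])
  · gcongr
    refine lintegral_mono_ae ?_
    filter_upwards [ae_restrict_mem measurableSet_Ioi] with s hs
    have hs0 : (0 : ℝ) < s := hs
    have h1 : delayed c₀ h c (s + h) = c s := by
      simp [delayed, hs0]
    have h2 : ∫ u in (0 : ℝ)..s, delayed c₀ h c (u + h) = ∫ u in (0 : ℝ)..s, c u := by
      refine intervalIntegral.integral_congr_ae (ae_of_all _ fun u hu => ?_)
      rw [uIoc_of_le hs0.le] at hu
      simp [delayed, hu.1]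
    rw [h1, h2]

/-- Upper half of dynamic programming. Consuming `m` up to `h` brings at most `q' * m` beyond the
`A` term, and costs at least `e^{-βh} * q * m` in continuation value. Since `q' ≤ e^{-βh} * q`,
consumption does not pay, and a bound independent of the rate remains. -/
theorem detValue_le_of_superdiff (hβ : 0 < β) (hg : Monotone g)
    {A q q' h : ℝ}
    (hA : 0 ≤ A) (hq' : 0 ≤ q') (hh : 0 ≤ h) (hqh : q' ≤ Real.exp (-β * h) * q)
    (hUA : ∀ c, 0 ≤ c → U c ≤ A + q' * c) (hgx : g x < ⊤)
    (hfin : ∀ y, l ≤ y → detValue U β g l y < ⊤)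
    (hW : ∀ y, l ≤ y → y ≤ x →
      (detValue U β g l y).toReal ≤ (detValue U β g l x).toReal - q * (x - y)) :
    detValue U β g l x ≤ ENNReal.ofReal ((1 - Real.exp (-β * h)) / β * (A + (g x).toReal) +
      Real.exp (-β * h) * (detValue U β g l x).toReal) := by
  conv_lhs => rw [detValue]
  refine iSup_le fun c => iSup_le fun hc => ?_
  set m := ∫ u in (0 : ℝ)..h, c u with hm
  have hm0 : 0 ≤ m := hc.integral_nonneg hh
  have hml : m ≤ x - l := hc.budget h hh
  have hexp : Real.exp (-β * h) ≤ 1 := Real.exp_le_one_iff.2 (by nlinarith)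
  have hfac : 0 ≤ (1 - Real.exp (-β * h)) / β := div_nonneg (by linarith) hβ.le
  have h1 : ∫⁻ s in Ioc 0 h, ENNReal.ofReal (Real.exp (-β * s)) *
      (ENNReal.ofReal (U (c s)) + g (x - ∫ u in (0 : ℝ)..s, c u)) ≤
      ENNReal.ofReal ((1 - Real.exp (-β * h)) / β) * (ENNReal.ofReal A + g x) +
        ENNReal.ofReal (q' * m) := by
    calc _ ≤ ∫⁻ s in Ioc 0 h, (ENNReal.ofReal (Real.exp (-β * s)) * (ENNReal.ofReal A + g x) +
          ENNReal.ofReal q' * ENNReal.ofReal (c s)) := by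
          refine setLIntegral_mono' measurableSet_Ioc fun s hs => ?_
          have hcs := hc.nonneg s hs.1.le
          have h2 : ENNReal.ofReal (U (c s)) ≤
              ENNReal.ofReal A + ENNReal.ofReal q' * ENNReal.ofReal (c s) := by
            rw [← ENNReal.ofReal_mul hq', ← ENNReal.ofReal_add hA (by positivity)]
            exact ENNReal.ofReal_le_ofReal (hUA _ hcs)
          have h3 : g (x - ∫ u in (0 : ℝ)..s, c u) ≤ g x :=
            hg (by linarith [hc.integral_nonneg hs.1.le])
          -- The discount is dropped only in front of `c s`, so that this part integrates to `q' *
          -- m`; it is kept on `A + g x`.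
          have h4 : ENNReal.ofReal (Real.exp (-β * s)) ≤ 1 := by
            rw [ENNReal.ofReal_le_one, Real.exp_le_one_iff]
            nlinarith [hs.1]
          calc _ ≤ ENNReal.ofReal (Real.exp (-β * s)) *
                (ENNReal.ofReal A + ENNReal.ofReal q' * ENNReal.ofReal (c s) + g x) := by gcongr
            _ = ENNReal.ofReal (Real.exp (-β * s)) * (ENNReal.ofReal A + g x) +
                ENNReal.ofReal (Real.exp (-β * s)) *
                  (ENNReal.ofReal q' * ENNReal.ofReal (c s)) := by ring
            _ ≤ ENNReal.ofReal (Real.exp (-β * s)) * (ENNReal.ofReal A + g x) +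
                1 * (ENNReal.ofReal q' * ENNReal.ofReal (c s)) := by gcongr
            _ = _ := by rw [one_mul]
      _ = _ := by
          rw [lintegral_add_left (by fun_prop), lintegral_mul_const _ (by fun_prop),
            lintegral_exp_Ioc hβ hh, lintegral_const_mul' _ _ ENNReal.ofReal_ne_top,
            ← ofReal_integral_eq_lintegral_ofReal
              ((intervalIntegrable_iff_integrableOn_Ioc_of_le hh).1 (hc.integrable h hh))
              ((ae_restrict_mem measurableSet_Ioc).mono fun t ht => hc.nonneg t ht.1.le),
            ← intervalIntegral.integral_of_le hh, ENNReal.ofReal_mul hq']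
  have h2 : detPayoff U β g (x - m) (fun s => c (s + h)) ≤
      ENNReal.ofReal ((detValue U β g l x).toReal - q * m) := by
    have h3 : detPayoff U β g (x - m) (fun s => c (s + h)) ≤ detValue U β g l (x - m) :=
      le_iSup_of_le _ (le_iSup_of_le (hc.shift hh) le_rfl)
    refine h3.trans ?_
    rw [← ENNReal.ofReal_toReal (hfin (x - m) (by linarith)).ne]
    apply ENNReal.ofReal_le_ofReal
    have := hW (x - m) (by linarith) (by linarith)
    rwa [sub_sub_cancel] at this
  have hWq : 0 ≤ (detValue U β g l x).toReal - q * m := by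
    have := hW (x - m) (by linarith) (by linarith)
    rw [sub_sub_cancel] at this
    exact ENNReal.toReal_nonneg.trans this
  rw [detPayoff_eq_add hc.integrable hh]
  calc _ ≤ (ENNReal.ofReal ((1 - Real.exp (-β * h)) / β) * (ENNReal.ofReal A + g x) +
        ENNReal.ofReal (q' * m)) + ENNReal.ofReal (Real.exp (-β * h)) *
          ENNReal.ofReal ((detValue U β g l x).toReal - q * m) := by gcongr
    _ = ENNReal.ofReal ((1 - Real.exp (-β * h)) / β * (A + (g x).toReal) + q' * m +
          Real.exp (-β * h) * ((detValue U β g l x).toReal - q * m)) := by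
        have hgr : 0 ≤ (g x).toReal := ENNReal.toReal_nonneg
        have hgx' : g x = ENNReal.ofReal (g x).toReal := (ENNReal.ofReal_toReal hgx.ne).symm
        conv_lhs => rw [hgx']
        rw [← ENNReal.ofReal_add hA hgr, ← ENNReal.ofReal_mul hfac,
          ← ENNReal.ofReal_add (by positivity) (by positivity),
          ← ENNReal.ofReal_mul (Real.exp_pos _).le,
          ← ENNReal.ofReal_add (by positivity) (by positivity)]
    _ ≤ _ := by
        apply ENNReal.ofReal_le_ofReal
        nlinarith

/-! ### The lower Hamilton-Jacobi inequality. -/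

/-- Running rewards that are monotone, and finite and concave on `[l, ∞)`. -/
structure IsReward (l : ℝ) (g : ℝ → ℝ≥0∞) : Prop where
  mono : Monotone g
  lt_top : ∀ x, l ≤ x → g x < ⊤
  concave : ∀ x y s t : ℝ, l ≤ x → l ≤ y → 0 ≤ s → 0 ≤ t → s + t = 1 →
    ENNReal.ofReal s * g x + ENNReal.ofReal t * g y ≤ g (s * x + t * y)

theorem IsReward.detValue_lt_top (hU : IsUtility U γ K₁) (hβ : 0 < β) (hg : IsReward l g)
    (hx : l ≤ x) : detValue U β g l x < ⊤ :=
  (detValue_le hU hβ hg.mono hx).trans_lt (ENNReal.add_lt_top.2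
    ⟨ENNReal.mul_lt_top ENNReal.ofReal_lt_top ENNReal.ofReal_lt_top,
      ENNReal.mul_lt_top ENNReal.ofReal_lt_top (hg.lt_top x hx)⟩)

theorem IsReward.concaveOn (hU : IsUtility U γ K₁) (hβ : 0 < β) (hg : IsReward l g) :
    ConcaveOn ℝ (Ici l) fun x => (detValue U β g l x).toReal := by
  refine ⟨convex_Ici l, fun x hx y hy s t hs ht hst => ?_⟩
  have hm : l ≤ s * x + t * y := (convex_Ici l) hx hy hs ht hst
  have h := ENNReal.toReal_mono (hg.detValue_lt_top hU hβ hm).ne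
    (detValue_concave (β := β) hU hg.concave hx hy hs ht hst)
  rw [ENNReal.toReal_add
    (ENNReal.mul_ne_top ENNReal.ofReal_ne_top (hg.detValue_lt_top hU hβ hx).ne)
    (ENNReal.mul_ne_top ENNReal.ofReal_ne_top (hg.detValue_lt_top hU hβ hy).ne),
    ENNReal.toReal_mul, ENNReal.toReal_mul, ENNReal.toReal_ofReal hs,
    ENNReal.toReal_ofReal ht] at h
  exact h

theorem IsReward.monotoneOn (hU : IsUtility U γ K₁) (hβ : 0 < β) (hg : IsReward l g) :
    MonotoneOn (fun x => (detValue U β g l x).toReal) (Ici l) := fun _ _ _ hy hxy =>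
  ENNReal.toReal_mono (hg.detValue_lt_top hU hβ hy).ne (detValue_mono hg.mono hxy)

/-- The supersolution inequality of the Hamilton-Jacobi equation, with a difference quotient in
place of the derivative. -/
theorem IsReward.supersolution (hU : IsUtility U γ K₁) (hβ : 0 < β) (hg : IsReward l g) {c₀ : ℝ}
    (hc₀ : 0 < c₀) (hy : l ≤ y) (hyx : y < x) :
    U c₀ + (g y).toReal ≤ β * (detValue U β g l x).toReal +
      c₀ * (((detValue U β g l x).toReal - (detValue U β g l y).toReal) / (x - y)) := by
  set W : ℝ → ℝ := fun x => (detValue U β g l x).toReal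
  change U c₀ + (g y).toReal ≤ β * W x + c₀ * ((W x - W y) / (x - y))
  set σ := (W x - W y) / (x - y) with hσ
  have hxl : l ≤ x := hy.trans hyx.le
  have hσ0 : 0 ≤ σ :=
    div_nonneg (sub_nonneg.2 (hg.monotoneOn hU hβ hy hxl hyx.le)) (by linarith)
  -- The time needed to bring the wealth from `x` down to `y` at the rate `c₀`.
  set h := (x - y) / c₀ with hh
  have hh0 : 0 < h := div_pos (by linarith) hc₀
  have hch : x - c₀ * h = y := by rw [hh]; field_simp; ring
  have hU0 := hU.nonneg hc₀.le
  have hexp : Real.exp (-β * h) < 1 :=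
    (Real.exp_lt_exp.2 (by nlinarith)).trans_eq Real.exp_zero
  have hfac : 0 < (1 - Real.exp (-β * h)) / β := div_pos (by linarith) hβ
  have h1 := detValue_ge_of_const (U := U) (l := l) hβ hg.mono hc₀.le hh0.le hch.ge
    (hy.trans hch.ge)
  rw [hch] at h1
  have h2 := ENNReal.toReal_mono (hg.detValue_lt_top hU hβ hxl).ne h1
  have hgy := (hg.lt_top y hy).ne
  rw [ENNReal.toReal_add (ENNReal.mul_ne_top ENNReal.ofReal_ne_top
      (ENNReal.add_ne_top.2 ⟨ENNReal.ofReal_ne_top, hgy⟩))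
    (ENNReal.mul_ne_top ENNReal.ofReal_ne_top (hg.detValue_lt_top hU hβ hy).ne),
    ENNReal.toReal_mul, ENNReal.toReal_mul, ENNReal.toReal_add ENNReal.ofReal_ne_top hgy,
    ENNReal.toReal_ofReal hfac.le, ENNReal.toReal_ofReal hU0,
    ENNReal.toReal_ofReal (Real.exp_pos _).le] at h2
  change (1 - Real.exp (-β * h)) / β * (U c₀ + (g y).toReal) + Real.exp (-β * h) * W y ≤ W x at h2
  have hWy : W y = W x - σ * (c₀ * h) := by
    have : c₀ * h = x - y := by linarith
    rw [this, hσ, div_mul_cancel₀ _ (by linarith)]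
    ring
  -- Equivalent to `1 + β h ≤ e^{β h}`; it allows division by the common factor `(1 - e^{-βh}) / β`.
  have h3 : Real.exp (-β * h) * h ≤ (1 - Real.exp (-β * h)) / β := by
    rw [le_div_iff₀ hβ]
    have h4 := Real.add_one_le_exp (β * h)
    have h5 : Real.exp (-β * h) * Real.exp (β * h) = 1 := by
      rw [← Real.exp_add]
      simp
    nlinarith [Real.exp_pos (-β * h)]
  rw [hWy] at h2
  have h6 : (1 - Real.exp (-β * h)) / β * (U c₀ + (g y).toReal) ≤
      (1 - Real.exp (-β * h)) / β * (β * W x + c₀ * σ) := by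
    have h7 : Real.exp (-β * h) * h * (c₀ * σ) ≤ (1 - Real.exp (-β * h)) / β * (c₀ * σ) :=
      mul_le_mul_of_nonneg_right h3 (by positivity)
    have h8 : (1 - Real.exp (-β * h)) / β * (β * W x) = (1 - Real.exp (-β * h)) * W x := by
      field_simp
    rw [mul_add _ (β * W x), h8]
    nlinarith
  exact le_of_mul_le_mul_left h6 hfac

/-- The supersolution inequality at a bound `r` of the slopes to the right of `x`. -/
theorem IsReward.supersolution_right (hU : IsUtility U γ K₁) (hβ : 0 < β) (hg : IsReward l g)
    {c₀ r : ℝ} (hc₀ : 0 < c₀) (hx : l < x)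
    (hr : ∀ z, x < z → ((detValue U β g l z).toReal - (detValue U β g l x).toReal) / (z - x) ≤ r) :
    U c₀ + (g x).toReal ≤ β * (detValue U β g l x).toReal + c₀ * r := by
  have hcont : ContinuousAt (fun x => (detValue U β g l x).toReal) x := by
    have := (hg.concaveOn hU hβ).continuousOn_interior
    rw [interior_Ici] at this
    exact this.continuousAt (Ioi_mem_nhds hx)
  have hlim : Tendsto (fun z => β * (detValue U β g l z).toReal + c₀ * r) (𝓝[>] x)
      (𝓝 (β * (detValue U β g l x).toReal + c₀ * r)) :=
    ((hcont.tendsto.const_mul β).add_const _).mono_left nhdsWithin_le_nhds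
  -- The inequality is applied between `x` and `z ↓ x`. The reward is evaluated at the lower
  -- endpoint `x`, so only the continuity of the value is needed, not that of `g`.
  refine ge_of_tendsto hlim ?_
  filter_upwards [self_mem_nhdsWithin] with z hz
  have h1 := hg.supersolution hU hβ hc₀ hx.le hz
  have h2 := mul_le_mul_of_nonneg_left (hr z hz) hc₀.le
  linarith

/-! ### Absence of kinks, continuity of the derivative and its blow-up at `l`. -/

theorem IsUtility.differentiableAt (hU : IsUtility U γ K₁) {c : ℝ} (hc : 0 < c) :
    DifferentiableAt ℝ U c :=
  ((hU.contDiff.differentiableOn one_ne_zero) c hc).differentiableAt (Ioi_mem_nhds hc)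

theorem IsUtility.le_tangent (hU : IsUtility U γ K₁) {c₀ c : ℝ} (hc₀ : 0 < c₀) (hc : 0 ≤ c) :
    U c ≤ U c₀ + deriv U c₀ * (c - c₀) := by
  have hconc := hU.strictConcave.concaveOn
  rcases lt_trichotomy c c₀ with h | rfl | h
  · have := hconc.deriv_le_slope hc hc₀.le h (hU.differentiableAt hc₀)
    rw [slope_def_field, le_div_iff₀ (by linarith)] at this
    linarith
  · simp
  · have := hconc.slope_le_deriv hc₀.le hc h (hU.differentiableAt hc₀)
    rw [slope_def_field, div_le_iff₀ (by linarith)] at this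
    linarith

/-- The Inada conditions and the continuity of `U'` let the intermediate value theorem reach every
positive slope. -/
theorem IsUtility.exists_deriv_eq (hU : IsUtility U γ K₁) {q : ℝ} (hq : 0 < q) :
    ∃ c, 0 < c ∧ deriv U c = q := by
  obtain ⟨a, ha, ha0⟩ :=
    ((hU.inada_zero.eventually_ge_atTop q).and self_mem_nhdsWithin).exists
  obtain ⟨b, hb, hb0⟩ :=
    ((hU.inada_top.eventually_le_const hq).and (eventually_ge_atTop a)).exists
  have hcont : ContinuousOn (deriv U) (Icc a b) :=
    (hU.contDiff.continuousOn_deriv_of_isOpen isOpen_Ioi le_rfl).mono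
      fun t ht => lt_of_lt_of_le ha0 ht.1
  obtain ⟨c, hc, hcq⟩ := intermediate_value_Icc' hb0 hcont ⟨hb, ha⟩
  exact ⟨c, lt_of_lt_of_le ha0 hc.1, hcq⟩

/-- Concavity gives one-sided derivatives `L ≥ R`. A slope strictly between them would contradict
the two Hamilton-Jacobi inequalities. -/
theorem IsReward.differentiableAt (hU : IsUtility U γ K₁) (hβ : 0 < β) (hg : IsReward l g)
    (hx : l < x) : DifferentiableAt ℝ (fun x => (detValue U β g l x).toReal) x := by
  set W : ℝ → ℝ := fun x => (detValue U β g l x).toReal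
  have hconc : ConcaveOn ℝ (Ici l) W := hg.concaveOn hU hβ
  have hconv : ConvexOn ℝ (Ici l) (-W) := hconc.neg
  have hint : x ∈ interior (Ici l) := by rwa [interior_Ici]
  have hR := (hconv.hasDerivWithinAt_rightDeriv_of_mem_interior hint).neg
  have hL := (hconv.hasDerivWithinAt_leftDeriv_of_mem_interior hint).neg
  have hRL := hconv.leftDeriv_le_rightDeriv_of_mem_interior hint
  rw [neg_neg] at hR hL
  set R := -derivWithin (-W) (Ioi x) x
  set L := -derivWithin (-W) (Iio x) x
  have hRslope : ∀ z, x < z → (W z - W x) / (z - x) ≤ R := fun z hz => by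
    have := hconc.slope_le_of_hasDerivWithinAt_Ioi hx.le (hx.le.trans hz.le) hz hR
    rwa [slope_def_field] at this
  have hLslope : ∀ y, l ≤ y → y ≤ x → W y ≤ W x - L * (x - y) := fun y hy hyx => by
    rcases hyx.eq_or_lt with rfl | hyx
    · simp
    · have := hconc.le_slope_of_hasDerivWithinAt_Iio hy hx.le hyx hL
      rw [slope_def_field, le_div_iff₀ (by linarith)] at this
      linarith
  have hR0 : 0 ≤ R := by
    refine le_trans (div_nonneg (sub_nonneg.2 ?_) ?_) (hRslope (x + 1) (by linarith))
    · exact hg.monotoneOn hU hβ hx.le (show l ≤ x + 1 by linarith) (by linarith)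
    · linarith
  have hLR : L = R := by
    refine le_antisymm (not_lt.1 fun hlt => ?_) (by simp only [L, R]; linarith)
    obtain ⟨q, hRq, hqL⟩ := exists_between hlt
    have hq : 0 < q := hR0.trans_lt hRq
    obtain ⟨c₀, hc₀, hUq⟩ := hU.exists_deriv_eq hq
    have htan : ∀ c, 0 ≤ c → U c ≤ (U c₀ - q * c₀) + q * c := fun c hc => by
      have := hU.le_tangent hc₀ hc
      rw [hUq] at this
      linarith
    -- This number is the maximum of `U c - q * c` over `c ≥ 0`, attained at `c₀`.
    have hA : 0 ≤ U c₀ - q * c₀ := by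
      have := htan 0 le_rfl
      rw [hU.map_zero] at this
      linarith
    -- The strict gap between `q` and `L` absorbs the discount over a short period.
    obtain ⟨h, hqh, hh⟩ : ∃ h, q < Real.exp (-β * h) * L ∧ 0 < h := by
      have ht : Tendsto (fun h => Real.exp (-β * h) * L) (𝓝[>] 0) (𝓝 L) := by
        have : Continuous fun h => Real.exp (-β * h) * L := by fun_prop
        have := this.tendsto 0
        simp only [mul_zero, Real.exp_zero, one_mul] at this
        exact this.mono_left nhdsWithin_le_nhds
      exact ((ht.eventually_const_lt hqL).and self_mem_nhdsWithin).exists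
    have h1 := detValue_le_of_superdiff hβ hg.mono hA hq.le hh.le hqh.le htan (hg.lt_top x hx.le)
      (fun y hy => hg.detValue_lt_top hU hβ hy) hLslope
    have hexp : Real.exp (-β * h) < 1 :=
    (Real.exp_lt_exp.2 (by nlinarith)).trans_eq Real.exp_zero
    have hfac : 0 < (1 - Real.exp (-β * h)) / β := div_pos (by linarith) hβ
    have hG : 0 ≤ (g x).toReal := ENNReal.toReal_nonneg
    have hWx : 0 ≤ W x := ENNReal.toReal_nonneg
    have h2 := ENNReal.toReal_mono ENNReal.ofReal_ne_top h1
    rw [ENNReal.toReal_ofReal (by positivity)] at h2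
    change W x ≤ _ + _ * W x at h2
    have h3 : β * W x ≤ U c₀ - q * c₀ + (g x).toReal := by
      have e : (1 - Real.exp (-β * h)) / β * (β * W x) = (1 - Real.exp (-β * h)) * W x := by
        field_simp
      refine le_of_mul_le_mul_left ?_ hfac
      rw [e]
      linarith
    have h4 : U c₀ + (g x).toReal ≤ β * W x + c₀ * R :=
      hg.supersolution_right hU hβ hc₀ hx hRslope
    -- `h3` and `h4` together give `c₀ * q ≤ c₀ * R`, against `R < q`.
    nlinarith
  rw [hLR] at hL
  have h := hL.Iic_of_Iio.union hR.Ici_of_Ioi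
  rw [Iic_union_Ici] at h
  exact (hasDerivWithinAt_univ.1 h).differentiableAt

/-- The derivative is antitone, so a discontinuity would be a jump, and a jump would skip values
that Darboux's theorem forces it to take. -/
theorem contDiffOn_one_of_concaveOn {f : ℝ → ℝ} {l : ℝ}
    (hf : ConcaveOn ℝ (Ioi l) f) (hd : ∀ x ∈ Ioi l, DifferentiableAt ℝ f x) :
    ContDiffOn ℝ 1 f (Ioi l) := by
  have hanti := hf.antitoneOn_deriv hd
  rw [contDiffOn_one_iff_derivWithin (uniqueDiffOn_Ioi l)]
  refine ⟨fun x hx => (hd x hx).differentiableWithinAt, ?_⟩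
  have hc : ContinuousOn (deriv f) (Ioi l) := by
    intro x hx
    refine ContinuousAt.continuousWithinAt ?_
    have hdarboux : ∀ a b, l < a → ∀ v ∈ uIcc (deriv f a) (deriv f b), l < b →
        ∃ z ∈ uIcc a b, deriv f z = v := by
      intro a b ha v hv hb
      have hsub : ∀ t ∈ uIcc a b, DifferentiableAt ℝ f t := fun t ht =>
        hd t (lt_of_lt_of_le (lt_min ha hb) ht.1)
      exact (ordConnected_uIcc.image_deriv hsub).uIcc_subset (mem_image_of_mem _ left_mem_uIcc)
        (mem_image_of_mem _ right_mem_uIcc) hv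
    refine tendsto_order.2 ⟨fun u hu => ?_, fun u hu => ?_⟩
    · obtain ⟨z, hxz, hz⟩ : ∃ z, x < z ∧ u < deriv f z := by
        by_contra! H
        obtain ⟨v, huv, hvx⟩ := exists_between hu
        have h1 := H (x + 1) (by linarith)
        obtain ⟨z, hz, rfl⟩ := hdarboux x (x + 1) hx v
          (by rw [uIcc_of_ge (h1.trans hu.le)]; exact ⟨h1.trans huv.le, hvx.le⟩)
          (lt_trans hx (by linarith))
        rw [uIcc_of_le (by linarith)] at hz
        rcases hz.1.eq_or_lt with rfl | h
        · exact lt_irrefl _ hvx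
        · exact absurd (H z h) (not_le.2 huv)
      filter_upwards [Ioo_mem_nhds hx hxz] with t ht
      exact hz.trans_le (hanti ht.1 (lt_trans hx hxz) ht.2.le)
    · obtain ⟨z, hlz, hzx, hz⟩ : ∃ z, l < z ∧ z < x ∧ deriv f z < u := by
        by_contra! H
        obtain ⟨v, hxv, hvu⟩ := exists_between hu
        obtain ⟨a, hla, hax⟩ := exists_between (mem_Ioi.1 hx)
        have h1 := H a hla hax
        obtain ⟨z, hz, rfl⟩ := hdarboux a x hla v
          (by rw [uIcc_of_ge (hu.le.trans h1)]; exact ⟨hxv.le, hvu.le.trans h1⟩) hx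
        rw [uIcc_of_le hax.le] at hz
        rcases hz.2.eq_or_lt with rfl | h
        · exact lt_irrefl _ hxv
        · exact absurd (H z (hla.trans_le hz.1) h) (not_le.2 hvu)
      filter_upwards [Ioi_mem_nhds hzx] with t ht
      exact (hanti hlz (hlz.trans ht) (le_of_lt ht)).trans_lt hz
  exact hc.congr fun x hx => derivWithin_of_isOpen isOpen_Ioi hx

/-- The terms `g x` of `detValue_le` and of the supersolution inequality cancel exactly, so the
behaviour of `g` near `l` plays no role. -/
theorem IsReward.tendsto_deriv (hU : IsUtility U γ K₁) (hβ : 0 < β) (hg : IsReward l g) :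
    Tendsto (deriv fun x => (detValue U β g l x).toReal) (𝓝[>] l) atTop := by
  set W : ℝ → ℝ := fun x => (detValue U β g l x).toReal
  have hconc : ConcaveOn ℝ (Ici l) W := hg.concaveOn hU hβ
  have hK := hU.K_pos
  refine tendsto_atTop.2 fun m => ?_
  obtain ⟨c₀, hmc, hc₀⟩ := ((hU.inada_zero.eventually_gt_atTop m).and self_mem_nhdsWithin).exists
  have hc₀ : 0 < c₀ := hc₀
  -- The tangent at `c₀`, evaluated at `0`, gives `U c₀ ≥ U'(c₀) * c₀`, and `U'(c₀) > m`.
  have hpos : 0 < U c₀ - m * c₀ := by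
    have := hU.le_tangent hc₀ le_rfl
    rw [hU.map_zero] at this
    nlinarith
  have hlim : Tendsto (fun x => β * (K₁ * (1 + 1 / β) * (x - l) ^ γ)) (𝓝[>] l) (𝓝 0) := by
    have : Continuous fun x => β * (K₁ * (1 + 1 / β) * (x - l) ^ γ) :=
      continuous_const.mul (continuous_const.mul
        ((Real.continuous_rpow_const hU.gamma_pos.le).comp (continuous_id.sub continuous_const)))
    have := this.tendsto l
    rw [sub_self, Real.zero_rpow hU.gamma_pos.ne', mul_zero, mul_zero] at this
    exact this.mono_left nhdsWithin_le_nhds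
  filter_upwards [hlim.eventually_lt_const hpos, self_mem_nhdsWithin] with x hsmall hx
  have hx : l < x := hx
  have hgx := hg.lt_top x hx.le
  have h1 : W x ≤ K₁ * (1 + 1 / β) * (x - l) ^ γ + 1 / β * (g x).toReal := by
    have h2 := ENNReal.toReal_mono (ENNReal.add_ne_top.2
      ⟨ENNReal.mul_ne_top ENNReal.ofReal_ne_top ENNReal.ofReal_ne_top,
        ENNReal.mul_ne_top ENNReal.ofReal_ne_top hgx.ne⟩) (detValue_le hU hβ hg.mono hx.le)
    rw [ENNReal.toReal_add (ENNReal.mul_ne_top ENNReal.ofReal_ne_top ENNReal.ofReal_ne_top)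
      (ENNReal.mul_ne_top ENNReal.ofReal_ne_top hgx.ne), ENNReal.toReal_mul, ENNReal.toReal_mul,
      ENNReal.toReal_ofReal (by positivity), ENNReal.toReal_ofReal
        (Real.rpow_nonneg (by linarith) _), ENNReal.toReal_ofReal (by positivity)] at h2
    exact h2
  have h3 : U c₀ + (g x).toReal ≤ β * W x + c₀ * deriv W x := by
    refine hg.supersolution_right hU hβ hc₀ hx fun z hz => ?_
    have := hconc.slope_le_deriv hx.le (hx.le.trans hz.le) hz (hg.differentiableAt hU hβ hx)
    rwa [slope_def_field] at this
  have h4 : β * W x ≤ β * (K₁ * (1 + 1 / β) * (x - l) ^ γ) + (g x).toReal := by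
    calc β * W x ≤ β * (K₁ * (1 + 1 / β) * (x - l) ^ γ + 1 / β * (g x).toReal) := by gcongr
      _ = _ := by field_simp
  have h5 : m * c₀ < c₀ * deriv W x := by linarith
  nlinarith

end Deterministic

/-! ### The gain is an admissible running reward; conclusion. -/

theorem Market.IsPoissonWith.isReward_gain {Ω : Type*} [MeasurableSpace Ω] {P : Measure Ω}
    [IsProbabilityMeasure P] {M : Market Ω} {lam ρ γ K₁ k b zlow : ℝ} {zbar : EReal}
    {p : Measure ℝ} {U : ℝ → ℝ} (hlam : 0 < lam) (hρ : 0 < ρ) (hU : IsUtility U γ K₁)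
    (hp : IsReturnLaw p zlow zbar k b) (hM : M.IsPoissonWith P lam p)
    (hdisc : b * γ + lam * (k ^ γ / zlow ^ γ - 1) < ρ) {a : ℝ} (ha : a ∈ investSet zbar) :
    IsReward (lowerWealth zlow zbar a) fun y => gain lam p (M.value P U ρ) y a := by
  obtain ⟨C, hC, hv⟩ := exists_value_le hlam hρ hU hp hM hdisc
  constructor
  · exact gain_mono value_mono a
  · intro y hy
    exact hp.gain_lt_top hU.gamma_pos hU.gamma_lt_one hC hv ha hy
  · intro x y s t hx hy hs ht hst
    refine hp.gain_concave (fun x y s t hx hy hs ht hst => ?_) ha hx hy hs ht hst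
    exact value_concave hU hx hy hs ht hst

end Illiquid

theorem mainTheorem3 {Ω : Type*} [MeasurableSpace Ω] (P : Measure Ω) [IsProbabilityMeasure P]
    (M : Illiquid.Market Ω) (lam ρ γ K₁ k b zlow : ℝ) (zbar : EReal) (p : Measure ℝ) (U : ℝ → ℝ)
    (hlam : 0 < lam) (hρ : 0 < ρ)
    (hU : Illiquid.IsUtility U γ K₁)
    (hp : Illiquid.IsReturnLaw p zlow zbar k b)
    (hM : M.IsPoissonWith P lam p)
    (hdisc : b * γ + lam * (k ^ γ / zlow ^ γ - 1) < ρ)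
    (vhat : ℝ → ℝ → ℝ≥0∞)
    (hvhat : vhat = Illiquid.auxValue U ρ lam zlow zbar p (M.value P U ρ))
    (a : ℝ) (ha : a ∈ Illiquid.investSet zbar) :
    (∀ x, Illiquid.lowerWealth zlow zbar a ≤ x → vhat x a < ⊤) ∧
      ContDiffOn ℝ 1 (fun x => (vhat x a).toReal) (Ioi (Illiquid.lowerWealth zlow zbar a)) ∧
      Tendsto (deriv fun x => (vhat x a).toReal) (𝓝[>] (Illiquid.lowerWealth zlow zbar a))
        atTop := by
  subst hvhat
  have hβ : 0 < ρ + lam := by positivity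
  have hg := hM.isReward_gain hlam hρ hU hp hdisc ha
  simp only [Illiquid.auxValue_eq]
  refine ⟨fun x hx => hg.detValue_lt_top hU hβ hx, ?_, hg.tendsto_deriv hU hβ⟩
  exact Illiquid.contDiffOn_one_of_concaveOn
    ((hg.concaveOn hU hβ).subset Ioi_subset_Ici_self (convex_Ioi _))
    fun x hx => hg.differentiableAt hU hβ hx
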